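/- For $\alpha>0$ and $p>0$ let the Fock space $\mathcal F^p_\alpha$ be the set of entire functions $f$ with $$\frac{p\alpha}{2\pi}\int_{\mathbb C}|f(z)|^p e^{-\frac{p\alpha}{2}|z|^2}\,dA(z)<\infty ,$$ where $A$ is the area measure. A sequence $\Lambda$ of complex numbers is called a zero set for $\mathcal F^p_\alpha$ if there is $f\in\mathcal F^p_\alpha\setminus\{0\}$ whose zeros, counted with multiplicity, are exactly the terms of $\Lambda$. Let $N_\Lambda(z,\rho)$ be the number of terms of $\Lambda$ in the open disk of center $z$ and radius $\rho$, and let $$\mathcal D^+(\Lambda)=\limsup_{\rho\to\infty}\,\sup_{z\in\mathbb C}\frac{N_\Lambda(z,\rho)}{\pi\rho^2},\qquad \mathcal D^-(\Lambda)=\liminf_{\rho\to\infty}\,\inf_{z\in\mathbb C}\frac{N_\Lambda(z,\rho)}{\pi\rho^2}.$$ **Theorem.** Let $\alpha>0$ and let $p>q>0$. There exists a sequence $\Lambda$ in $\mathbb C$ such that $\mathcal D^+(\Lambda)=\mathcal D^-(\Lambda)=\alpha/\pi$ and such that $\Lambda$ is a zero set for $\mathcal F^p_\alpha$ but not for $\mathcal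 F^q_\alpha$. More precisely, let $a=\sqrt{\pi/\alpha}$ and let $R$ be any number with $1/p<R<1/q$. Then the sequence $\Lambda_R=\{w_{m,n}: m,n\in\mathbb Z\}$, where $w_{m,n}=a(m+in)$ if $n\neq0$ or $m=n=0$, and $w_{m,0}=a(m+Rm/|m|)$ if $m\neq0$, has all these properties. -/

import Mathlib

open scoped ENNReal Topology
open MeasureTheory Filter

noncomputable section

/-- The measure `dA_β(z) = (β / π) e^{-β |z|²} dA(z)` on `ℂ`, where `A` is the area measure. -/
def gaussianArea (β : ℝ) : Measure ℂ :=
  (volume : Measure ℂ).withDensity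
    (fun z => ENNReal.ofReal (β / Real.pi * Real.exp (-β * ‖z‖ ^ 2)))

/-- The Fock space `F^p_α`: the entire functions `f` with
`∫ |f(z)|^p dA_{pα/2}(z) < ∞`. -/
def fockSpace (α p : ℝ) : Set (ℂ → ℂ) :=
  {f | Differentiable ℂ f ∧ ∫⁻ z, ‖f z‖ₑ ^ p ∂(gaussianArea (p * α / 2)) < ∞}

/-- The sequence `Λ` is a zero set for `F^p_α`: some `f ∈ F^p_α`, `f ≠ 0`, vanishes at every
`z` to an order which is exactly the number of occurrences of `z` in `Λ`. -/
def IsFockZeroSet {ι : Type*} (α p : ℝ) (Λ : ι → ℂ) : Prop :=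
  ∃ f ∈ fockSpace α p, f ≠ 0 ∧ ∀ z : ℂ, analyticOrderAt f z = {i : ι | Λ i = z}.encard

/-- `N_Λ(z, ρ)`: the number of terms of `Λ` in the open disk of center `z` and radius `ρ`. -/
def diskCount {ι : Type*} (Λ : ι → ℂ) (z : ℂ) (ρ : ℝ) : ℕ∞ :=
  {i : ι | Λ i ∈ Metric.ball z ρ}.encard

/-- The upper Beurling–Landau density, as a value in `[0, ∞]`. -/
def upperDensity {ι : Type*} (Λ : ι → ℂ) : ℝ≥0∞ :=
  limsup (fun ρ : ℝ => ⨆ z : ℂ, (diskCount Λ z ρ : ℝ≥0∞) / ENNReal.ofReal (Real.pi * ρ ^ 2)) atTop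

/-- The lower Beurling–Landau density, as a value in `[0, ∞]`. -/
def lowerDensity {ι : Type*} (Λ : ι → ℂ) : ℝ≥0∞ :=
  liminf (fun ρ : ℝ => ⨅ z : ℂ, (diskCount Λ z ρ : ℝ≥0∞) / ENNReal.ofReal (Real.pi * ρ ^ 2)) atTop

/-- The square lattice of spacing `a`, with its nonzero real points shifted outward by `a R`. -/
def shiftedLattice (a R : ℝ) (k : ℤ × ℤ) : ℂ :=
  if k.2 ≠ 0 ∨ k.1 = 0 then (a : ℂ) * ((k.1 : ℂ) + Complex.I * (k.2 : ℂ))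
  else ((a * ((k.1 : ℝ) + R * (k.1 : ℝ) / |(k.1 : ℝ)|) : ℝ) : ℂ)

end

/-! Moving lattice points by a bounded distance does not affect Beurling–Landau densities, but
moving one row can change the growth of the associated entire function by a power of `‖z‖`. Pushing
the nonzero real points outward by `R` costs a factor `‖z‖ ^ (-2R)`, and the `p`-th power of that,
against `r dr`, is integrable at infinity exactly when `R p > 1`. Everything is computed for spacing
`1` and rescaled.

For membership, `latticeFunction` is an explicit function with the required zeros: reciprocal Gamma
functions for the real axis, `q`-products for the rows above and below it, and a Gaussian factor
`exp (π z² / 2)` that makes the growth isotropic. The estimate `latticeFunction_bound` gives `‖z‖ ^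
(-2R) exp (π ‖z‖² / 2)` up to a constant, so `R p > 1` suffices.

For non-membership, let `G` be any entire function with these zeros. Jensen's formula
(`sum_posLog_le_circleAverage`) bounds the circle mean of `log ‖G‖` below by a sum over the zeros.
Comparing the sum over Gaussian integers with an area integral (`exists_le_sum_posLog_gaussPoint`)
and then paying for the shift (`exists_le_sum_posLog_shiftedLattice`) yields `α r² / 2 - 2 R log r -
O(1)`. By convexity of `exp` the mean of `‖G‖ ^ q` is at least a constant times `exp (q α r² / 2) r
^ (-2Rq)`, and `∫ r ^ (1 - 2Rq) dr` diverges when `R q < 1`. This applies to every such `G` at once,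
so no factorization theorem is needed. -/

/-! ### Densities: comparing points with the cells of a square grid. -/

/-- The half-open square cell of side `a` with lower left corner `a (k.1 + i k.2)`. -/
def cornerCell (a : ℝ) (k : ℤ × ℤ) : Set ℂ :=
  {z | ⌊z.re / a⌋ = k.1 ∧ ⌊z.im / a⌋ = k.2}

lemma volume_reProdIm (s t : Set ℝ) : volume (s ×ℂ t) = volume s * volume t := by
  have h : s ×ℂ t = Complex.measurableEquivRealProd ⁻¹' (s ×ˢ t) := by
    ext z; simp [Complex.mem_reProdIm]
  rw [h, Complex.volume_preserving_equiv_real_prod.measure_preimage_equiv, Measure.volume_eq_prod,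
    Measure.prod_prod]

lemma cornerCell_eq {a : ℝ} (ha : 0 < a) (k : ℤ × ℤ) :
    cornerCell a k =
      Set.Ico (a * k.1) (a * (k.1 + 1)) ×ℂ Set.Ico (a * k.2) (a * (k.2 + 1)) := by
  ext z
  simp only [cornerCell, Set.mem_ofPred_eq, Complex.mem_reProdIm, Int.floor_eq_iff, Set.mem_Ico,
    le_div_iff₀ ha, div_lt_iff₀ ha, mul_comm a]

lemma measurableSet_cornerCell {a : ℝ} (ha : 0 < a) (k : ℤ × ℤ) :
    MeasurableSet (cornerCell a k) := by
  rw [cornerCell_eq ha]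
  exact (measurableSet_Ico.preimage Complex.measurable_re).inter
    (measurableSet_Ico.preimage Complex.measurable_im)

lemma volume_cornerCell {a : ℝ} (ha : 0 < a) (k : ℤ × ℤ) :
    volume (cornerCell a k) = ENNReal.ofReal (a ^ 2) := by
  rw [cornerCell_eq ha, volume_reProdIm, Real.volume_Ico, Real.volume_Ico,
    ← ENNReal.ofReal_mul (by nlinarith)]
  congr 1
  ring

lemma volume_biUnion_cornerCell {a : ℝ} (ha : 0 < a) (S : Set (ℤ × ℤ)) :
    volume (⋃ k ∈ S, cornerCell a k) = S.encard * ENNReal.ofReal (a ^ 2) := by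
  rw [measure_biUnion S.to_countable _ fun k _ => measurableSet_cornerCell ha k]
  · simp only [volume_cornerCell ha, ENNReal.tsum_set_const]
  · intro k _ l _ hkl
    rw [Function.onFun, Set.disjoint_left]
    rintro z ⟨h1, h2⟩ ⟨h3, h4⟩
    exact hkl (Prod.ext (h1.symm.trans h3) (h2.symm.trans h4))

/-- If the `k`-th term of `Λ` is uniformly close to the cell number `k`, then the counting function
of `Λ` is close to the normalized area. -/
lemma diskCount_bounds {a δ : ℝ} (ha : 0 < a) {Λ : ℤ × ℤ → ℂ}
    (hΛ : ∀ k, ∀ z ∈ cornerCell a k, dist (Λ k) z ≤ δ) (z : ℂ) (ρ : ℝ) :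
    ENNReal.ofReal (ρ - δ) ^ 2 * NNReal.pi ≤ (diskCount Λ z ρ : ℝ≥0∞) * ENNReal.ofReal (a ^ 2) ∧
    (diskCount Λ z ρ : ℝ≥0∞) * ENNReal.ofReal (a ^ 2) ≤ ENNReal.ofReal (ρ + δ) ^ 2 * NNReal.pi := by
  rw [← Complex.volume_ball z, ← Complex.volume_ball z, diskCount, ← volume_biUnion_cornerCell ha]
  -- The ball of radius `ρ - δ` is covered by the cells whose points lie in the ball of radius `ρ`,
  -- and those cells stay inside the ball of radius `ρ + δ`.
  constructor
  · refine measure_mono fun w hw => ?_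
    simp only [Set.mem_iUnion, Set.mem_ofPred_eq, Metric.mem_ball] at hw ⊢
    refine ⟨(⌊w.re / a⌋, ⌊w.im / a⌋), ?_, rfl, rfl⟩
    have h1 := hΛ (⌊w.re / a⌋, ⌊w.im / a⌋) w ⟨rfl, rfl⟩
    linarith [dist_triangle (Λ (⌊w.re / a⌋, ⌊w.im / a⌋)) w z]
  · refine measure_mono fun w hw => ?_
    simp only [Set.mem_iUnion, Set.mem_ofPred_eq, Metric.mem_ball, exists_prop] at hw ⊢
    obtain ⟨k, hk, hwk⟩ := hw
    have h1 := hΛ k w hwk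
    rw [dist_comm] at h1
    linarith [dist_triangle w (Λ k) z]

/-- The bounds `(1 ∓ δ / ρ)² / a²` do not depend on the center, so they squeeze both the supremum
and the infimum over `z`. -/
lemma densities_eq {a δ : ℝ} (ha : 0 < a) {Λ : ℤ × ℤ → ℂ}
    (hΛ : ∀ k, ∀ z ∈ cornerCell a k, dist (Λ k) z ≤ δ) :
    upperDensity Λ = ENNReal.ofReal (1 / a ^ 2) ∧
      lowerDensity Λ = ENNReal.ofReal (1 / a ^ 2) := by
  have ha2 : 0 < a ^ 2 := by positivity
  have key : ∀ ρ : ℝ, 0 < ρ → δ < ρ → 0 ≤ ρ + δ → ∀ z,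
      ENNReal.ofReal ((1 - δ / ρ) ^ 2 / a ^ 2) ≤
        (diskCount Λ z ρ : ℝ≥0∞) / ENNReal.ofReal (Real.pi * ρ ^ 2) ∧
      (diskCount Λ z ρ : ℝ≥0∞) / ENNReal.ofReal (Real.pi * ρ ^ 2) ≤
        ENNReal.ofReal ((1 + δ / ρ) ^ 2 / a ^ 2) := by
    intro ρ hρ hδ hδ' z
    have hπ : (NNReal.pi : ℝ≥0∞) = ENNReal.ofReal Real.pi := by
      rw [ENNReal.ofReal, ← NNReal.coe_real_pi, Real.toNNReal_coe]
    have hpos : 0 < Real.pi * ρ ^ 2 := by positivity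
    have h0 : ENNReal.ofReal (Real.pi * ρ ^ 2) ≠ 0 := by simpa using hpos
    have h0' : ENNReal.ofReal (a ^ 2) ≠ 0 := by simpa using ha.ne'
    obtain ⟨h1, h2⟩ := diskCount_bounds ha hΛ z ρ
    rw [hπ, ← ENNReal.ofReal_pow (by linarith), ← ENNReal.ofReal_mul (by positivity)] at h1 h2
    constructor
    · rw [ENNReal.le_div_iff_mul_le (Or.inl h0) (Or.inl ENNReal.ofReal_ne_top),
        ← ENNReal.ofReal_mul (by positivity)]
      rw [← ENNReal.mul_le_mul_iff_left h0' ENNReal.ofReal_ne_top,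
        ← ENNReal.ofReal_mul (by positivity)]
      refine le_trans (le_of_eq ?_) h1
      congr 1
      field_simp
    · rw [ENNReal.div_le_iff h0 ENNReal.ofReal_ne_top,
        ← ENNReal.ofReal_mul (by positivity)]
      rw [← ENNReal.mul_le_mul_iff_left h0' ENNReal.ofReal_ne_top,
        ← ENNReal.ofReal_mul (by positivity)]
      refine h2.trans (le_of_eq ?_)
      congr 1
      field_simp
  have hlim : ∀ c : ℝ, Tendsto (fun ρ : ℝ => ENNReal.ofReal ((1 + c / ρ) ^ 2 / a ^ 2)) atTop
      (𝓝 (ENNReal.ofReal (1 / a ^ 2))) := by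
    intro c
    refine ENNReal.tendsto_ofReal ?_
    have h : Tendsto (fun ρ : ℝ => c / ρ) atTop (𝓝 0) := tendsto_const_nhds.div_atTop tendsto_id
    simpa using ((h.const_add 1).pow 2).div_const (a ^ 2)
  have hlow := hlim (-δ)
  simp only [neg_div, ← sub_eq_add_neg] at hlow
  have hev : ∀ᶠ ρ : ℝ in atTop, 0 < ρ ∧ δ < ρ ∧ 0 ≤ ρ + δ := by
    filter_upwards [eventually_gt_atTop 0, eventually_gt_atTop δ, eventually_gt_atTop (-δ)]
      with ρ h1 h2 h3
    exact ⟨h1, h2, by linarith⟩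
  constructor
  · refine Tendsto.limsup_eq (tendsto_of_tendsto_of_tendsto_of_le_of_le' hlow (hlim δ) ?_ ?_)
    · filter_upwards [hev] with ρ h
      exact (key ρ h.1 h.2.1 h.2.2 0).1.trans
        (le_iSup (fun z => (diskCount Λ z ρ : ℝ≥0∞) / ENNReal.ofReal (Real.pi * ρ ^ 2)) 0)
    · filter_upwards [hev] with ρ h
      exact iSup_le fun z => (key ρ h.1 h.2.1 h.2.2 z).2
  · refine Tendsto.liminf_eq (tendsto_of_tendsto_of_tendsto_of_le_of_le' hlow (hlim δ) ?_ ?_)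
    · filter_upwards [hev] with ρ h
      exact le_iInf fun z => (key ρ h.1 h.2.1 h.2.2 z).1
    · filter_upwards [hev] with ρ h
      exact (iInf_le (fun z => (diskCount Λ z ρ : ℝ≥0∞) / ENNReal.ofReal (Real.pi * ρ ^ 2)) 0).trans
        (key ρ h.1 h.2.1 h.2.2 0).2

/-! ### Geometry of the shifted lattice; invariance under reindexing. -/

lemma shiftedLattice_of_ne {a R : ℝ} {k : ℤ × ℤ} (h : k.2 ≠ 0) :
    shiftedLattice a R k = (a : ℂ) * ((k.1 : ℂ) + Complex.I * (k.2 : ℂ)) := by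
  simp [shiftedLattice, h]

/-- The convention `0 / 0 = 0` lets one formula serve the whole axis, the origin included. -/
lemma shiftedLattice_axis (a R : ℝ) (m : ℤ) :
    shiftedLattice a R (m, 0) = ((a * (m + R * m / |(m : ℝ)|) : ℝ) : ℂ) := by
  by_cases h : m = 0 <;> simp [shiftedLattice, h]

lemma shiftedLattice_im (a R : ℝ) (k : ℤ × ℤ) : (shiftedLattice a R k).im = a * k.2 := by
  by_cases h : k.2 = 0
  · obtain ⟨m, n⟩ := k
    obtain rfl : n = 0 := h
    rw [shiftedLattice_axis, Complex.ofReal_im]; simp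
  · rw [shiftedLattice_of_ne h]; simp

lemma abs_shiftedLattice_re_sub_le {a R : ℝ} (ha : 0 < a) (hR : 0 ≤ R) (k : ℤ × ℤ) :
    |(shiftedLattice a R k).re - a * k.1| ≤ a * R := by
  by_cases h : k.2 = 0
  · obtain ⟨m, n⟩ := k
    obtain rfl : n = 0 := h
    rw [shiftedLattice_axis, Complex.ofReal_re]
    have : a * ((m : ℝ) + R * m / |(m : ℝ)|) - a * m = a * R * (m / |(m : ℝ)|) := by ring
    rw [this, abs_mul, abs_of_nonneg (by positivity : 0 ≤ a * R), abs_div, abs_abs]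
    exact mul_le_of_le_one_right (by positivity) (div_self_le_one _)
  · rw [shiftedLattice_of_ne h]
    simp; positivity

lemma dist_shiftedLattice_le {a R : ℝ} (ha : 0 < a) (hR : 0 ≤ R) (k : ℤ × ℤ) :
    ∀ z ∈ cornerCell a k, dist (shiftedLattice a R k) z ≤ a * (R + 2) := by
  intro z hz
  rw [cornerCell_eq ha] at hz
  obtain ⟨⟨h1, h2⟩, h3, h4⟩ := hz
  rw [dist_eq_norm]
  refine (Complex.norm_le_abs_re_add_abs_im _).trans ?_
  have h5 := abs_le.1 (abs_shiftedLattice_re_sub_le ha hR k)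
  have h6 : |(shiftedLattice a R k - z).re| ≤ a * (R + 1) := by
    rw [Complex.sub_re, abs_le]; constructor <;> nlinarith
  have h7 : |(shiftedLattice a R k - z).im| ≤ a := by
    rw [Complex.sub_im, shiftedLattice_im, abs_le]; constructor <;> nlinarith
  linarith

lemma encard_setOf_comp_equiv {ι κ : Type*} (e : κ ≃ ι) (P : ι → Prop) :
    {i : κ | P (e i)}.encard = {i : ι | P i}.encard := by
  have : {i : ι | P i} = e '' {i : κ | P (e i)} := by
    ext i; simp
  rw [this, e.injective.encard_image]

lemma diskCount_comp_equiv {ι κ : Type*} (e : κ ≃ ι) (Λ : ι → ℂ) :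
    diskCount (Λ ∘ e) = diskCount Λ := by
  ext z ρ : 2
  exact encard_setOf_comp_equiv e fun i => Λ i ∈ Metric.ball z ρ

lemma upperDensity_comp_equiv {ι κ : Type*} (e : κ ≃ ι) (Λ : ι → ℂ) :
    upperDensity (Λ ∘ e) = upperDensity Λ := by
  simp only [upperDensity, diskCount_comp_equiv]

lemma lowerDensity_comp_equiv {ι κ : Type*} (e : κ ≃ ι) (Λ : ι → ℂ) :
    lowerDensity (Λ ∘ e) = lowerDensity Λ := by
  simp only [lowerDensity, diskCount_comp_equiv]

lemma isFockZeroSet_comp_equiv {ι κ : Type*} (e : κ ≃ ι) (α p : ℝ) (Λ : ι → ℂ) :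
    IsFockZeroSet α p (Λ ∘ e) ↔ IsFockZeroSet α p Λ := by
  have h : ∀ z, {i : κ | (Λ ∘ e) i = z}.encard = {i : ι | Λ i = z}.encard :=
    fun z => encard_setOf_comp_equiv e fun i => Λ i = z
  simp only [IsFockZeroSet, h]

/-! ### An entire function with simple zeros at the shifted lattice. -/

/-- Translations, reflections and dilations below are written as `c * w + d`, even when `c = 1` or
`d = 0`, so that this lemma rewrites all of them. -/
lemma analyticOrderAt_comp_mul_add (h : ℂ → ℂ) {c : ℂ} (hc : c ≠ 0) (d z : ℂ) :
    analyticOrderAt (fun w => h (c * w + d)) z = analyticOrderAt h (c * z + d) := by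
  have hd : HasDerivAt (fun w : ℂ => c * w + d) c z := by
    simpa using ((hasDerivAt_id z).const_mul c).add_const d
  exact analyticOrderAt_comp_of_deriv_ne_zero (f := h) (g := fun w : ℂ => c * w + d) (by fun_prop)
    (by rw [hd.deriv]; exact hc)

lemma analyticOrderAt_eq_zero_of_ne {f : ℂ → ℂ} {z : ℂ} (h : f z ≠ 0) :
    analyticOrderAt f z = 0 :=
  analyticOrderAt_eq_zero.2 (Or.inr h)

lemma analyticOrderAt_fun_mul {f g : ℂ → ℂ} (hf : Differentiable ℂ f)
    (hg : Differentiable ℂ g) (z : ℂ) :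
    analyticOrderAt (fun w => f w * g w) z = analyticOrderAt f z + analyticOrderAt g z :=
  analyticOrderAt_mul (hf.analyticAt z) (hg.analyticAt z)

lemma analyticOrderAt_mul_left_of_ne {f g : ℂ → ℂ} (hf : Differentiable ℂ f)
    (hg : Differentiable ℂ g) {z : ℂ} (h : f z ≠ 0) :
    analyticOrderAt (fun w => f w * g w) z = analyticOrderAt g z := by
  rw [analyticOrderAt_fun_mul hf hg, analyticOrderAt_eq_zero_of_ne h, zero_add]

lemma analyticOrderAt_mul_right_of_ne {f g : ℂ → ℂ} (hf : Differentiable ℂ f)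
    (hg : Differentiable ℂ g) {z : ℂ} (h : g z ≠ 0) :
    analyticOrderAt (fun w => f w * g w) z = analyticOrderAt f z := by
  simp only [mul_comm (f _)]
  exact analyticOrderAt_mul_left_of_ne hg hf h

lemma analyticOrderAt_id_eq_one : analyticOrderAt (fun w : ℂ => w) 0 = 1 :=
  analyticOrderAt_id

/-- The reciprocal of the Gamma function has simple zeros at the non-positive integers. -/
lemma analyticOrderAt_inv_Gamma (n : ℕ) :
    analyticOrderAt (fun s : ℂ => (Complex.Gamma s)⁻¹) (-n) = 1 := by
  have hG := Complex.differentiable_one_div_Gamma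
  -- The identity `1 / Γ(s) = s / Γ(s + 1)` produces the zero at `0` from the factor `s`, and
  -- carries the zero at `-(n + 1)` to the one at `-n`.
  have hfun : (fun s : ℂ => (Complex.Gamma s)⁻¹) = fun s => s * (Complex.Gamma (1 * s + 1))⁻¹ := by
    ext s
    simpa using Complex.one_div_Gamma_eq_self_mul_one_div_Gamma_add_one s
  have hG1 : Differentiable ℂ fun s : ℂ => (Complex.Gamma (1 * s + 1))⁻¹ :=
    hG.comp (by fun_prop : Differentiable ℂ fun s : ℂ => 1 * s + 1)
  induction n with
  | zero =>
    rw [hfun, analyticOrderAt_mul_right_of_ne differentiable_fun_id hG1 (by simp)]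
    simpa using analyticOrderAt_id_eq_one
  | succ n ih =>
    rw [hfun, analyticOrderAt_mul_left_of_ne differentiable_fun_id hG1
      (by rw [neg_ne_zero]; exact_mod_cast Nat.succ_ne_zero n),
      analyticOrderAt_comp_mul_add (fun s => (Complex.Gamma s)⁻¹) one_ne_zero]
    convert ih using 2
    push_cast; ring

/-- The factor `1 - exp (2 π i (z + i (n + 1)))`, up to the constant `1`. -/
noncomputable def rowTerm (n : ℕ) (z : ℂ) : ℂ :=
  -Complex.exp (2 * Real.pi * Complex.I * (z + Complex.I * (n + 1)))

/-- The entire function `∏_{n ≥ 1} (1 - exp (2 π i (z + i n)))`, with zeros `m - i n`. -/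
noncomputable def rowProduct (z : ℂ) : ℂ := ∏' n : ℕ, (1 + rowTerm n z)

lemma norm_rowTerm (n : ℕ) (z : ℂ) :
    ‖rowTerm n z‖ = Real.exp (-2 * Real.pi * z.im) * Real.exp (-2 * Real.pi) ^ (n + 1) := by
  rw [rowTerm, norm_neg, Complex.norm_exp, ← Real.exp_nat_mul, ← Real.exp_add]
  congr 1
  simp
  ring

lemma exp_neg_two_pi_lt_one : Real.exp (-2 * Real.pi) < 1 := by
  rw [Real.exp_lt_one_iff]; linarith [Real.pi_pos]

lemma summable_exp_pow : Summable fun n : ℕ => Real.exp (-2 * Real.pi) ^ (n + 1) :=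
  (summable_nat_add_iff 1).2
    (summable_geometric_of_lt_one (Real.exp_pos _).le exp_neg_two_pi_lt_one)

lemma summable_norm_rowTerm (z : ℂ) : Summable fun n => ‖rowTerm n z‖ := by
  simp only [norm_rowTerm]
  exact summable_exp_pow.mul_left _

lemma differentiable_rowTerm (n : ℕ) : Differentiable ℂ (rowTerm n) := by
  unfold rowTerm; fun_prop

lemma differentiable_rowProduct : Differentiable ℂ rowProduct := by
  have h : HasProdLocallyUniformlyOn (fun n z => 1 + rowTerm n z) rowProduct Set.univ := by
    apply hasProdLocallyUniformlyOn_of_forall_compact isOpen_univ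
    intro K _ hcK
    obtain ⟨B, hB⟩ := hcK.exists_bound_of_continuousOn
      (f := fun z : ℂ => Real.exp (-2 * Real.pi * z.im)) (by fun_prop)
    refine (summable_exp_pow.mul_left B).hasProdUniformlyOn_nat_one_add
      hcK (.of_forall fun n x hx => ?_) (fun n => (differentiable_rowTerm n).continuous.continuousOn)
    rw [norm_rowTerm]
    gcongr
    exact (le_abs_self _).trans (hB x hx)
  rw [← differentiableOn_univ]
  refine h.differentiableOn (.of_forall fun s => ?_) isOpen_univ
  simpa [Finset.prod_fn] using DifferentiableOn.finsetProd (s := Set.univ)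
    (fun n _ => ((differentiable_rowTerm n).const_add 1).differentiableOn)

lemma rowProduct_ne_zero {z : ℂ} (h : ∀ n, 1 + rowTerm n z ≠ 0) : rowProduct z ≠ 0 :=
  tprod_one_add_ne_zero_of_summable h (summable_norm_rowTerm z)

lemma one_add_rowTerm_eq_zero_iff (n : ℕ) (z : ℂ) :
    1 + rowTerm n z = 0 ↔ ∃ m : ℤ, z = m - Complex.I * (n + 1) := by
  rw [rowTerm, ← sub_eq_add_neg, sub_eq_zero, eq_comm, Complex.exp_eq_one_iff]
  have h2 : 2 * (Real.pi : ℂ) * Complex.I ≠ 0 := Complex.two_pi_I_ne_zero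
  refine exists_congr fun m => ?_
  rw [mul_comm (m : ℂ), mul_right_inj' h2, eq_sub_iff_add_eq]

/-- Shifting by `i` drops the first factor. This functional equation drives both inductions on rows:
for the orders of the zeros and for the growth in the lower half-plane. -/
lemma rowProduct_eq (z : ℂ) :
    rowProduct z = (1 + rowTerm 0 z) * rowProduct (1 * z + Complex.I) := by
  have h := tprod_eq_zero_mul' (f := fun n => 1 + rowTerm n z)
    ((multipliable_one_add_of_summable
      ((summable_nat_add_iff 1).2 (summable_norm_rowTerm z))))
  rw [rowProduct, h, rowProduct]
  congr 2
  ext n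
  simp only [rowTerm]
  congr 3
  push_cast
  ring

lemma differentiable_rowProduct_add : Differentiable ℂ fun z => rowProduct (1 * z + Complex.I) :=
  differentiable_rowProduct.comp (by fun_prop : Differentiable ℂ fun z => 1 * z + Complex.I)

lemma analyticOrderAt_one_add_rowTerm (m : ℤ) :
    analyticOrderAt (fun z => 1 + rowTerm 0 z) (m - Complex.I) = 1 := by
  have h0 : 1 + rowTerm 0 (m - Complex.I) = 0 :=
    (one_add_rowTerm_eq_zero_iff 0 _).2 ⟨m, by simp⟩
  refine AnalyticAt.analyticOrderAt_eq_one_of_zero_deriv_ne_zero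
    (((differentiable_rowTerm 0).const_add 1).analyticAt _) h0 ?_
  have hd : HasDerivAt (fun z => 1 + rowTerm 0 z)
      (rowTerm 0 (m - Complex.I) * (2 * Real.pi * Complex.I)) (m - Complex.I) := by
    have h1 : HasDerivAt (fun z : ℂ => 2 * (Real.pi : ℂ) * Complex.I *
        (z + Complex.I * ((0 : ℕ) + 1))) (2 * Real.pi * Complex.I) (m - Complex.I) := by
      simpa using ((hasDerivAt_id (m - Complex.I)).add_const
        (Complex.I * ((0 : ℕ) + 1))).const_mul (2 * (Real.pi : ℂ) * Complex.I)
    simpa [rowTerm] using (h1.cexp.neg).const_add 1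
  rw [hd.deriv]
  refine mul_ne_zero ?_ Complex.two_pi_I_ne_zero
  simp [rowTerm]

lemma rowProduct_ne_zero_of_forall {z : ℂ} (h : ∀ (m : ℤ) (n : ℕ), z ≠ m - Complex.I * (n + 1)) :
    rowProduct z ≠ 0 :=
  rowProduct_ne_zero fun n hn => by
    obtain ⟨m, hm⟩ := (one_add_rowTerm_eq_zero_iff n z).1 hn
    exact h m n hm

lemma rowProduct_ne_zero_of_im {z : ℂ} (h : -1 < z.im) : rowProduct z ≠ 0 :=
  rowProduct_ne_zero_of_forall fun m n hz => by
    rw [hz] at h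
    simp at h
    linarith [Nat.cast_nonneg (α := ℝ) n]

/-- The zeros of `rowProduct` are simple. -/
lemma analyticOrderAt_rowProduct (m : ℤ) (n : ℕ) :
    analyticOrderAt rowProduct (m - Complex.I * (n + 1)) = 1 := by
  have hfun : rowProduct = fun z => (1 + rowTerm 0 z) * rowProduct (1 * z + Complex.I) :=
    funext rowProduct_eq
  have hd := (differentiable_rowTerm 0).const_add 1
  induction n with
  | zero =>
    rw [hfun, analyticOrderAt_mul_right_of_ne hd differentiable_rowProduct_add
      (rowProduct_ne_zero_of_im (by simp))]
    simpa using analyticOrderAt_one_add_rowTerm m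
  | succ n ih =>
    rw [hfun, analyticOrderAt_mul_left_of_ne hd differentiable_rowProduct_add,
      analyticOrderAt_comp_mul_add rowProduct one_ne_zero]
    · convert ih using 2
      push_cast; ring
    · intro h
      obtain ⟨k, hk⟩ := (one_add_rowTerm_eq_zero_iff 0 _).1 h
      have := congrArg Complex.im hk
      simp at this
      have h1 : (0 : ℝ) ≤ n := Nat.cast_nonneg n
      linarith

/-- The entire function with zeros `0` and `± (m + R)`, `m ≥ 1`, given by the Gamma function. -/
noncomputable def axisFactor (R : ℝ) (z : ℂ) : ℂ :=
  z * ((Complex.Gamma (1 * z + (1 + R)))⁻¹ * (Complex.Gamma ((-1) * z + (1 + R)))⁻¹)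

/-- The entire function with simple zeros at the shifted lattice of spacing `1`. -/
noncomputable def latticeFunction (R : ℝ) (z : ℂ) : ℂ :=
  Complex.exp (Real.pi / 2 * z ^ 2) *
    (axisFactor R z * (rowProduct (1 * z + 0) * rowProduct ((-1) * z + 0)))

lemma differentiable_inv_Gamma_comp (c d : ℂ) :
    Differentiable ℂ fun z => (Complex.Gamma (c * z + d))⁻¹ :=
  Complex.differentiable_one_div_Gamma.comp (by fun_prop : Differentiable ℂ fun z => c * z + d)

lemma differentiable_rowProduct_comp (c d : ℂ) :
    Differentiable ℂ fun z => rowProduct (c * z + d) :=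
  differentiable_rowProduct.comp (by fun_prop : Differentiable ℂ fun z => c * z + d)

lemma differentiable_axisFactor (R : ℝ) : Differentiable ℂ (axisFactor R) :=
  differentiable_id.mul
    ((differentiable_inv_Gamma_comp _ _).mul (differentiable_inv_Gamma_comp _ _))

lemma differentiable_latticeFunction (R : ℝ) : Differentiable ℂ (latticeFunction R) :=
  (by fun_prop : Differentiable ℂ fun z : ℂ => Complex.exp (Real.pi / 2 * z ^ 2)).mul
    ((differentiable_axisFactor R).mul
      ((differentiable_rowProduct_comp _ _).mul (differentiable_rowProduct_comp _ _)))

lemma analyticOrderAt_latticeFunction (R : ℝ) (z : ℂ) :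
    analyticOrderAt (latticeFunction R) z = analyticOrderAt (axisFactor R) z +
      (analyticOrderAt rowProduct z + analyticOrderAt rowProduct (-z)) := by
  have h1 := differentiable_rowProduct_comp 1 0
  have h2 := differentiable_rowProduct_comp (-1) 0
  have h3 := differentiable_axisFactor R
  unfold latticeFunction
  rw [analyticOrderAt_mul_left_of_ne
    (by fun_prop : Differentiable ℂ fun z : ℂ => Complex.exp (Real.pi / 2 * z ^ 2))
    (h3.fun_mul (h1.fun_mul h2)) (Complex.exp_ne_zero _), analyticOrderAt_fun_mul h3 (h1.fun_mul h2),
    analyticOrderAt_fun_mul h1 h2, analyticOrderAt_comp_mul_add rowProduct one_ne_zero,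
    analyticOrderAt_comp_mul_add rowProduct (by simp : (-1 : ℂ) ≠ 0)]
  simp only [one_mul, add_zero, neg_mul]

lemma analyticOrderAt_axisFactor (R : ℝ) (z : ℂ) :
    analyticOrderAt (axisFactor R) z = analyticOrderAt (fun w : ℂ => w) z +
      (analyticOrderAt (fun s : ℂ => (Complex.Gamma s)⁻¹) (z + (1 + R)) +
        analyticOrderAt (fun s : ℂ => (Complex.Gamma s)⁻¹) (-z + (1 + R))) := by
  have h1 := differentiable_inv_Gamma_comp 1 (1 + R)
  have h2 := differentiable_inv_Gamma_comp (-1) (1 + R)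
  unfold axisFactor
  rw [analyticOrderAt_fun_mul differentiable_fun_id (h1.fun_mul h2), analyticOrderAt_fun_mul h1 h2,
    analyticOrderAt_comp_mul_add (fun s => (Complex.Gamma s)⁻¹) one_ne_zero,
    analyticOrderAt_comp_mul_add (fun s => (Complex.Gamma s)⁻¹) (by simp : (-1 : ℂ) ≠ 0)]
  simp only [one_mul, neg_mul]

lemma signed_shift_cases (R m : ℝ) :
    (m < 0 ∧ m + R * m / |m| = m - R) ∨ (m = 0 ∧ m + R * m / |m| = 0) ∨
      (0 < m ∧ m + R * m / |m| = m + R) := by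
  rcases lt_trichotomy m 0 with hm | rfl | hm
  · refine Or.inl ⟨hm, ?_⟩
    rw [abs_of_neg hm, div_neg, mul_div_assoc, div_self hm.ne]
    ring
  · simp
  · refine Or.inr (Or.inr ⟨hm, ?_⟩)
    rw [abs_of_pos hm, mul_div_assoc, div_self hm.ne', mul_one]

/-- The imaginary part determines the row, and on the real axis an outward shift preserves the
order. Hence all prescribed zeros are simple. -/
lemma shiftedLattice_injective {a R : ℝ} (ha : 0 < a) (hR : 0 ≤ R) :
    Function.Injective (shiftedLattice a R) := by
  rintro ⟨m, n⟩ ⟨m', n'⟩ h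
  have him := congrArg Complex.im h
  rw [shiftedLattice_im, shiftedLattice_im] at him
  have hn : n = n' := by exact_mod_cast mul_left_cancel₀ ha.ne' him
  subst hn
  suffices m = m' by rw [this]
  by_cases hn : n = 0
  · subst hn
    rw [shiftedLattice_axis, shiftedLattice_axis, Complex.ofReal_inj] at h
    have h1 := mul_left_cancel₀ ha.ne' h
    have h2 : (m : ℝ) = m' := by
      rcases signed_shift_cases R m with ⟨hm, e⟩ | ⟨hm, e⟩ | ⟨hm, e⟩ <;>
      rcases signed_shift_cases R m' with ⟨hm', e'⟩ | ⟨hm', e'⟩ | ⟨hm', e'⟩ <;>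
      linarith
    exact_mod_cast h2
  · have h1 := congrArg Complex.re h
    rw [shiftedLattice_of_ne hn, shiftedLattice_of_ne hn] at h1
    simp at h1
    rcases h1 with h1 | h1
    · exact_mod_cast h1
    · exact absurd h1 ha.ne'

lemma inv_Gamma_order_eq_zero {s : ℂ} (h : ∀ m : ℕ, s ≠ -m) :
    analyticOrderAt (fun s : ℂ => (Complex.Gamma s)⁻¹) s = 0 :=
  analyticOrderAt_eq_zero_of_ne (inv_ne_zero (Complex.Gamma_ne_zero h))

lemma ne_neg_natCast_of_im {s : ℂ} (h : s.im ≠ 0) (m : ℕ) : s ≠ -m := by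
  rintro rfl; simp at h

lemma ne_neg_natCast_of_re {s : ℂ} (h : 0 < s.re) (m : ℕ) : s ≠ -m := by
  rintro rfl
  simp at h
  linarith [Nat.cast_nonneg (α := ℝ) m]

lemma analyticOrderAt_fun_id_of_ne {z : ℂ} (h : z ≠ 0) : analyticOrderAt (fun w : ℂ => w) z = 0 :=
  analyticOrderAt_eq_zero_of_ne h

lemma analyticOrderAt_axisFactor_of_im {R : ℝ} {z : ℂ} (h : z.im ≠ 0) :
    analyticOrderAt (axisFactor R) z = 0 := by
  rw [analyticOrderAt_axisFactor, analyticOrderAt_fun_id_of_ne (by rintro rfl; simp at h),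
    inv_Gamma_order_eq_zero (ne_neg_natCast_of_im (by simpa using h)),
    inv_Gamma_order_eq_zero (ne_neg_natCast_of_im (by simpa using h))]
  simp

lemma analyticOrderAt_axisFactor_natCast_add {R : ℝ} (hR : 0 < R) (m : ℕ) :
    analyticOrderAt (axisFactor R) (m + 1 + R) = 1 ∧
      analyticOrderAt (axisFactor R) (-(m + 1 + R)) = 1 := by
  have hm : (0 : ℝ) ≤ m := Nat.cast_nonneg m
  have h0 : (m + 1 + R : ℂ) ≠ 0 := by
    intro h
    have := congrArg Complex.re h
    simp at this
    linarith
  have h1 : analyticOrderAt (fun s : ℂ => (Complex.Gamma s)⁻¹) ((m + 1 + R) + (1 + R)) = 0 :=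
    inv_Gamma_order_eq_zero (ne_neg_natCast_of_re (by simp; linarith))
  have h2 : (-(m + 1 + R) + (1 + R) : ℂ) = -m := by ring
  constructor
  · rw [analyticOrderAt_axisFactor, analyticOrderAt_fun_id_of_ne h0, h1, h2,
      analyticOrderAt_inv_Gamma]
    simp
  · rw [analyticOrderAt_axisFactor, analyticOrderAt_fun_id_of_ne (neg_ne_zero.2 h0), neg_neg, h1, h2,
      analyticOrderAt_inv_Gamma]
    simp

lemma analyticOrderAt_axisFactor_zero {R : ℝ} (hR : 0 < R) :
    analyticOrderAt (axisFactor R) 0 = 1 := by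
  rw [analyticOrderAt_axisFactor, analyticOrderAt_id_eq_one,
    inv_Gamma_order_eq_zero (ne_neg_natCast_of_re (by simp; linarith)),
    inv_Gamma_order_eq_zero (ne_neg_natCast_of_re (by simp; linarith))]
  simp

lemma rowProduct_order_of_im {z : ℂ} (h : -1 < z.im) : analyticOrderAt rowProduct z = 0 :=
  analyticOrderAt_eq_zero_of_ne (rowProduct_ne_zero_of_im h)

lemma shiftedLattice_one_pos (R : ℝ) (m : ℕ) :
    shiftedLattice 1 R ((m : ℤ) + 1, 0) = m + 1 + R := by
  have h : (0 : ℝ) < m + 1 := by positivity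
  rw [shiftedLattice_axis]
  push_cast
  rw [abs_of_pos h]
  push_cast
  rw [mul_div_assoc, div_self (by exact_mod_cast h.ne')]
  ring

lemma shiftedLattice_one_neg (R : ℝ) (m : ℕ) :
    shiftedLattice 1 R (-((m : ℤ) + 1), 0) = -(m + 1 + R) := by
  have h : (0 : ℝ) < m + 1 := by positivity
  rw [shiftedLattice_axis]
  push_cast
  rw [abs_of_neg (by linarith : (-(m + 1) : ℝ) < 0), neg_neg]
  push_cast
  rw [mul_div_assoc, neg_div, div_self (by exact_mod_cast h.ne')]
  ring

/-- `latticeFunction R` vanishes simply on the lattice, and nowhere else. -/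
lemma analyticOrderAt_latticeFunction_shiftedLattice {R : ℝ} (hR : 0 < R) (k : ℤ × ℤ) :
    analyticOrderAt (latticeFunction R) (shiftedLattice 1 R k) = 1 := by
  obtain ⟨m, n⟩ := k
  rw [analyticOrderAt_latticeFunction]
  rcases lt_trichotomy n 0 with hn | rfl | hn
  · have hz := shiftedLattice_of_ne (a := 1) (R := R) (k := (m, n)) hn.ne
    obtain ⟨j, rfl⟩ : ∃ j : ℕ, n = -((j : ℤ) + 1) := ⟨(-n - 1).toNat, by omega⟩
    have hz' : shiftedLattice 1 R (m, -((j : ℤ) + 1)) = m - Complex.I * (j + 1) := by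
      rw [hz]; push_cast; ring
    have hj : (0 : ℝ) ≤ j := Nat.cast_nonneg j
    rw [hz', analyticOrderAt_rowProduct, rowProduct_order_of_im (by simp; linarith),
      analyticOrderAt_axisFactor_of_im (by simp; linarith)]
    simp
  · have him : (shiftedLattice 1 R (m, 0)).im = 0 := by simp [shiftedLattice_im]
    rw [rowProduct_order_of_im (by rw [him]; norm_num),
      rowProduct_order_of_im (by rw [Complex.neg_im, him]; norm_num), add_zero, add_zero]
    rcases lt_trichotomy m 0 with hm | rfl | hm
    · obtain ⟨j, rfl⟩ : ∃ j : ℕ, m = -((j : ℤ) + 1) := ⟨(-m - 1).toNat, by omega⟩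
      rw [shiftedLattice_one_neg, (analyticOrderAt_axisFactor_natCast_add hR j).2]
    · rw [shiftedLattice_axis]
      simpa using analyticOrderAt_axisFactor_zero hR
    · obtain ⟨j, rfl⟩ : ∃ j : ℕ, m = (j : ℤ) + 1 := ⟨(m - 1).toNat, by omega⟩
      rw [shiftedLattice_one_pos, (analyticOrderAt_axisFactor_natCast_add hR j).1]
  · have hz := shiftedLattice_of_ne (a := 1) (R := R) (k := (m, n)) hn.ne'
    obtain ⟨j, rfl⟩ : ∃ j : ℕ, n = (j : ℤ) + 1 := ⟨(n - 1).toNat, by omega⟩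
    have hz' : shiftedLattice 1 R (m, (j : ℤ) + 1) = -((-m : ℤ) - Complex.I * (j + 1)) := by
      rw [hz]; push_cast; ring
    have hj : (0 : ℝ) ≤ j := Nat.cast_nonneg j
    rw [hz', neg_neg, analyticOrderAt_rowProduct, rowProduct_order_of_im (by simp; linarith),
      analyticOrderAt_axisFactor_of_im (by simp; linarith)]
    simp

lemma latticeFunction_ne_zero {R : ℝ} {z : ℂ} (hz : ∀ k, shiftedLattice 1 R k ≠ z) :
    latticeFunction R z ≠ 0 := by
  have h1 : rowProduct z ≠ 0 := rowProduct_ne_zero_of_forall fun m n h => by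
    refine hz (m, -((n : ℤ) + 1)) ?_
    rw [shiftedLattice_of_ne (by simp; omega), h]
    push_cast; ring
  have h2 : rowProduct (-z) ≠ 0 := rowProduct_ne_zero_of_forall fun m n h => by
    refine hz (-m, (n : ℤ) + 1) ?_
    rw [shiftedLattice_of_ne (by simp; omega), ← neg_neg z, h]
    push_cast; ring
  have h3 : z ≠ 0 := fun h => hz (0, 0) (by rw [shiftedLattice_axis, h]; simp)
  have h4 : Complex.Gamma (z + (1 + R)) ≠ 0 := Complex.Gamma_ne_zero fun m h => by
    refine hz (-((m : ℤ) + 1), 0) ?_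
    rw [shiftedLattice_one_neg, eq_sub_of_add_eq h]
    ring
  have h5 : Complex.Gamma (-z + (1 + R)) ≠ 0 := Complex.Gamma_ne_zero fun m h => by
    refine hz ((m : ℤ) + 1, 0) ?_
    rw [shiftedLattice_one_pos, ← neg_neg z, eq_sub_of_add_eq h]
    ring
  simp [latticeFunction, axisFactor, h1, h2, h3, h4, h5, Complex.exp_ne_zero]

lemma shiftedLattice_eq_mul (a R : ℝ) (k : ℤ × ℤ) :
    shiftedLattice a R k = a * shiftedLattice 1 R k := by
  by_cases h : k.2 ≠ 0 ∨ k.1 = 0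
  · simp only [shiftedLattice, if_pos h]; push_cast; ring
  · simp only [shiftedLattice, if_neg h]; push_cast; ring

lemma analyticOrderAt_eq_encard {a R : ℝ} (ha : 0 < a) (hR : 0 < R) (z : ℂ) :
    analyticOrderAt (fun w => latticeFunction R ((a : ℂ)⁻¹ * w + 0)) z =
      {k | shiftedLattice a R k = z}.encard := by
  have hac : (a : ℂ) ≠ 0 := by exact_mod_cast ha.ne'
  rw [analyticOrderAt_comp_mul_add _ (inv_ne_zero hac)]
  by_cases h : ∃ k, shiftedLattice a R k = z
  · obtain ⟨k, rfl⟩ := h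
    have hset : {l | shiftedLattice a R l = shiftedLattice a R k} = {k} := by
      ext l
      simp [(shiftedLattice_injective ha hR.le).eq_iff]
    rw [hset, Set.encard_singleton, shiftedLattice_eq_mul, inv_mul_cancel_left₀ hac, add_zero,
      analyticOrderAt_latticeFunction_shiftedLattice hR]
  · push Not at h
    have hset : {l | shiftedLattice a R l = z} = ∅ := by
      ext l
      simp [h l]
    rw [hset, Set.encard_empty]
    refine analyticOrderAt_eq_zero_of_ne (latticeFunction_ne_zero fun k hk => h k ?_)
    rw [shiftedLattice_eq_mul, hk, add_zero, mul_inv_cancel_left₀ hac]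

/-! ### Growth of the axis factor, through a quotient estimate for Gamma. -/

/-- Since `‖1 + x‖² = 1 + 2 Re x + ‖x‖²`, this is `1 + t ≤ exp t`. The exponent is exact to first
order, so the errors in the infinite product are summable. -/
lemma norm_one_add_le_exp (x : ℂ) : ‖1 + x‖ ≤ Real.exp (x.re + ‖x‖ ^ 2 / 2) := by
  have h1 : ‖1 + x‖ ^ 2 = (2 * x.re + ‖x‖ ^ 2) + 1 := by
    rw [← Complex.normSq_eq_norm_sq, ← Complex.normSq_eq_norm_sq, Complex.normSq_apply,
      Complex.normSq_apply]
    simp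
    ring
  have h2 : ‖1 + x‖ ^ 2 ≤ Real.exp (x.re + ‖x‖ ^ 2 / 2) ^ 2 := by
    rw [h1, ← Real.exp_nat_mul]
    refine (Real.add_one_le_exp _).trans (le_of_eq ?_)
    congr 1
    push_cast
    ring
  exact le_of_sq_le_sq h2 (Real.exp_pos _).le

/-- As `1 - v = w / (w + 1)`, the preceding bound at `-v` can be read backwards. It replaces `exp
(Re v)` by a quotient of consecutive norms, which telescopes. -/
lemma exp_re_le (v : ℂ) (w : ℂ) (hw : w ≠ 0) (hw1 : w + 1 ≠ 0) (hv : v = (w + 1)⁻¹) :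
    Real.exp v.re ≤ Real.exp (‖v‖ ^ 2 / 2) * (‖w + 1‖ / ‖w‖) := by
  have h1 : w / (w + 1) = 1 + -v := by rw [hv]; field_simp; ring
  have h2 : ‖w‖ / ‖w + 1‖ ≤ Real.exp (-v.re + ‖v‖ ^ 2 / 2) := by
    rw [← norm_div, h1]
    simpa using norm_one_add_le_exp (-v)
  rw [Real.exp_add, Real.exp_neg, div_le_iff₀ (norm_pos_iff.2 hw1)] at h2
  have h3 := norm_pos_iff.2 hw
  have h4 := Real.exp_pos v.re
  rw [mul_div_assoc', le_div_iff₀ h3]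
  calc Real.exp v.re * ‖w‖ ≤ Real.exp v.re *
        ((Real.exp v.re)⁻¹ * Real.exp (‖v‖ ^ 2 / 2) * ‖w + 1‖) := by gcongr
    _ = _ := by field_simp

/-- Each factor with `j ≥ 1` is at most `(‖u + j‖ / ‖u + j - 1‖) ^ s` up to `exp (O(1 / j²))`, and
these powers telescope. The factor `j = 0` has no predecessor and accounts for `s / c`. -/
lemma prod_norm_one_add_div_le {s c : ℝ} (hs : 0 < s) (hc : 0 < c) {u : ℂ}
    (hu : ∀ j : ℕ, c * (j + 1) ≤ ‖u + j‖) (n : ℕ) :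
    ∏ j ∈ Finset.range (n + 1), ‖1 + s / (u + j)‖ ≤
      Real.exp (s / c + ∑ j ∈ Finset.range n, ((s ^ 2 + s) / 2 / c ^ 2) * (1 / ((j : ℝ) + 1) ^ 2)) *
        (‖u + n‖ / ‖u‖) ^ s := by
  have hpos : ∀ j : ℕ, 0 < ‖u + j‖ := fun j => lt_of_lt_of_le (by positivity) (hu j)
  have hu0 : 0 < ‖u‖ := by simpa using hpos 0
  induction n with
  | zero =>
    have h0 : c ≤ ‖u‖ := by simpa using hu 0
    simp only [zero_add, Finset.prod_range_one, Nat.cast_zero, add_zero, Finset.range_zero,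
      Finset.sum_empty, div_self hu0.ne', Real.one_rpow, mul_one]
    calc ‖1 + (s : ℂ) / u‖ ≤ ‖(1 : ℂ)‖ + ‖(s : ℂ) / u‖ := norm_add_le _ _
      _ = s / ‖u‖ + 1 := by
        rw [norm_one, norm_div, Complex.norm_real, Real.norm_of_nonneg hs.le, add_comm]
      _ ≤ s / c + 1 := by gcongr
      _ ≤ _ := Real.add_one_le_exp _
  | succ n ih =>
    rw [Finset.prod_range_succ, Finset.sum_range_succ]
    have hw := norm_pos_iff.1 (hpos n)
    have hw1 := norm_pos_iff.1 (hpos (n + 1))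
    have hcast : u + ((n + 1 : ℕ) : ℂ) = u + n + 1 := by push_cast; ring
    rw [hcast] at hw1 ⊢
    set v : ℂ := (u + n + 1)⁻¹ with hv
    have h1 : ‖1 + s / (u + n + 1)‖ ≤ Real.exp (s * v.re + s ^ 2 * ‖v‖ ^ 2 / 2) := by
      have := norm_one_add_le_exp (s * v)
      rw [div_eq_mul_inv, ← hv]
      refine this.trans (le_of_eq ?_)
      rw [norm_mul, Complex.norm_real, Real.norm_of_nonneg hs.le, Complex.re_ofReal_mul]
      ring_nf
    have h2 : Real.exp (s * v.re) ≤ Real.exp (s * (‖v‖ ^ 2 / 2)) * (‖u + n + 1‖ / ‖u + n‖) ^ s := by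
      have := Real.rpow_le_rpow (Real.exp_pos _).le (exp_re_le v (u + n) hw hw1 hv) hs.le
      rw [Real.mul_rpow (Real.exp_pos _).le (by positivity), ← Real.exp_mul, ← Real.exp_mul] at this
      rwa [mul_comm s, mul_comm s]
    have h3 : ‖v‖ ^ 2 ≤ 1 / c ^ 2 * (1 / ((n : ℝ) + 1) ^ 2) := by
      have h4 : c * (n + 1) ≤ ‖u + n + 1‖ := by
        have := hu (n + 1)
        rw [hcast] at this
        refine le_trans ?_ this
        push_cast
        nlinarith
      rw [hv, norm_inv, inv_pow, one_div_mul_one_div, ← mul_pow, ← one_div]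
      gcongr
    have h5 : ‖1 + s / (u + n + 1)‖ ≤
        Real.exp ((s ^ 2 + s) / 2 / c ^ 2 * (1 / ((n : ℝ) + 1) ^ 2)) *
          (‖u + n + 1‖ / ‖u + n‖) ^ s := by
      calc _ ≤ Real.exp (s * v.re) * Real.exp (s ^ 2 * ‖v‖ ^ 2 / 2) := by rwa [← Real.exp_add]
        _ ≤ Real.exp (s * (‖v‖ ^ 2 / 2)) * (‖u + n + 1‖ / ‖u + n‖) ^ s *
            Real.exp (s ^ 2 * ‖v‖ ^ 2 / 2) := by gcongr
        _ = Real.exp ((s ^ 2 + s) / 2 * ‖v‖ ^ 2) * (‖u + n + 1‖ / ‖u + n‖) ^ s := by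
          rw [mul_right_comm, ← Real.exp_add]; ring_nf
        _ ≤ _ := by
          refine mul_le_mul_of_nonneg_right (Real.exp_le_exp.2 ?_) (by positivity)
          calc _ ≤ (s ^ 2 + s) / 2 * (1 / c ^ 2 * (1 / ((n : ℝ) + 1) ^ 2)) :=
                mul_le_mul_of_nonneg_left h3 (by positivity)
            _ = _ := by ring
    calc _ ≤ _ := mul_le_mul ih h5 (norm_nonneg _) (by positivity)
      _ = _ := by
        have hn := hpos n
        rw [mul_mul_mul_comm, ← Real.exp_add, ← Real.mul_rpow (by positivity) (by positivity),
          add_assoc]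
        congr 2
        field_simp

/-- A bound for the quotient of two values of the Gamma function. -/
lemma norm_Gamma_le_norm_Gamma_add {s c : ℝ} (hs : 0 < s) (hc : 0 < c) :
    ∃ C : ℝ, 0 < C ∧ ∀ u : ℂ, (∀ j : ℕ, c * (j + 1) ≤ ‖u + j‖) → 0 < (u + s).re →
      ‖Complex.Gamma u‖ ≤ C * ‖u‖ ^ (-s) * ‖Complex.Gamma (u + s)‖ := by
  set K : ℝ := (s ^ 2 + s) / 2 / c ^ 2
  have hsum : Summable fun j : ℕ => K * (1 / ((j : ℝ) + 1) ^ 2) := by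
    refine Summable.mul_left _ ?_
    have := (summable_nat_add_iff 1).2 (Real.summable_one_div_nat_pow.2 one_lt_two)
    simpa using this
  refine ⟨Real.exp (s / c + ∑' j : ℕ, K * (1 / ((j : ℝ) + 1) ^ 2)), Real.exp_pos _, ?_⟩
  intro u hu hus
  have hpos : ∀ j : ℕ, 0 < ‖u + j‖ := fun j => lt_of_lt_of_le (by positivity) (hu j)
  have hu0 : 0 < ‖u‖ := by simpa using hpos 0
  set C := Real.exp (s / c + ∑' j : ℕ, K * (1 / ((j : ℝ) + 1) ^ 2))
  have hne : ∀ j : ℕ, u + s + j ≠ 0 := fun j h => by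
    have := congrArg Complex.re h
    simp at this hus
    linarith [Nat.cast_nonneg (α := ℝ) j]
  -- In Gauss's limit formula the quotient of the approximants at `u` and `u + s` has norm `n ^ (-s)
  -- ∏ ‖1 + s / (u + j)‖`. The leftover `(‖u + n‖ / n) ^ s` tends to `1`.
  have key : ∀ n : ℕ, 0 < n → ‖Complex.GammaSeq u n‖ ≤
      ‖Complex.GammaSeq (u + s) n‖ * (C * ‖u‖ ^ (-s) * (‖u + n‖ / n) ^ s) := by
    intro n hn
    have hn' : (0 : ℝ) < n := by exact_mod_cast hn
    have hprod : ∏ j ∈ Finset.range (n + 1), ‖u + s + j‖ =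
        (∏ j ∈ Finset.range (n + 1), ‖u + j‖) *
          ∏ j ∈ Finset.range (n + 1), ‖1 + s / (u + j)‖ := by
      rw [← Finset.prod_mul_distrib]
      refine Finset.prod_congr rfl fun j _ => ?_
      rw [← norm_mul]
      congr 1
      have := norm_pos_iff.1 (hpos j)
      field_simp
      ring
    have hp1 : 0 < ∏ j ∈ Finset.range (n + 1), ‖u + j‖ := Finset.prod_pos fun j _ => hpos j
    have hp2 : 0 < ∏ j ∈ Finset.range (n + 1), ‖1 + s / (u + j)‖ := by
      have : 0 < ∏ j ∈ Finset.range (n + 1), ‖u + s + j‖ :=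
        Finset.prod_pos fun j _ => norm_pos_iff.2 (hne j)
      rw [hprod] at this
      exact pos_of_mul_pos_right this hp1.le
    have hle := prod_norm_one_add_div_le hs hc hu n
    have hle2 : ∏ j ∈ Finset.range (n + 1), ‖1 + s / (u + j)‖ ≤ C * (‖u + n‖ / ‖u‖) ^ s := by
      refine hle.trans ?_
      refine mul_le_mul_of_nonneg_right (Real.exp_le_exp.2 (add_le_add_right ?_ _)) (by positivity)
      exact hsum.sum_le_tsum _ fun j _ => by positivity
    have e1 : ‖Complex.GammaSeq u n‖ = (n : ℝ) ^ u.re * n.factorial /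
        ∏ j ∈ Finset.range (n + 1), ‖u + j‖ := by
      rw [Complex.GammaSeq, norm_div, norm_mul, norm_prod, Complex.norm_natCast_cpow_of_pos hn,
        Complex.norm_natCast]
    have e2 : ‖Complex.GammaSeq (u + s) n‖ = (n : ℝ) ^ u.re * (n : ℝ) ^ s * n.factorial /
        ((∏ j ∈ Finset.range (n + 1), ‖u + j‖) *
          ∏ j ∈ Finset.range (n + 1), ‖1 + s / (u + j)‖) := by
      rw [Complex.GammaSeq, norm_div, norm_mul, norm_prod, Complex.norm_natCast_cpow_of_pos hn,
        Complex.norm_natCast, hprod, ← Real.rpow_add hn']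
      simp
    have e3 : ‖Complex.GammaSeq u n‖ = ‖Complex.GammaSeq (u + s) n‖ *
        ((n : ℝ) ^ s)⁻¹ * ∏ j ∈ Finset.range (n + 1), ‖1 + s / (u + j)‖ := by
      rw [e1, e2]
      have := Real.rpow_pos_of_pos hn' s
      field_simp
    rw [e3, mul_assoc]
    refine mul_le_mul_of_nonneg_left ?_ (norm_nonneg _)
    calc _ ≤ ((n : ℝ) ^ s)⁻¹ * (C * (‖u + n‖ / ‖u‖) ^ s) :=
          mul_le_mul_of_nonneg_left hle2 (by positivity)
      _ = _ := by
        rw [Real.div_rpow (hpos n).le hu0.le, Real.div_rpow (hpos n).le hn'.le,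
          Real.rpow_neg hu0.le]
        ring
  have hlim : Tendsto (fun n : ℕ => ‖u + n‖ / (n : ℝ)) atTop (𝓝 1) := by
    have h1 : Tendsto (fun n : ℕ => ‖u / n + 1‖) atTop (𝓝 1) := by
      have : Tendsto (fun n : ℕ => u / (n : ℂ)) atTop (𝓝 0) := tendsto_const_div_atTop_nhds_zero_nat u
      simpa using (this.add_const 1).norm
    refine h1.congr' ?_
    filter_upwards [eventually_gt_atTop 0] with n hn
    have hn' : (n : ℂ) ≠ 0 := by exact_mod_cast hn.ne'
    rw [div_add_one hn', norm_div, Complex.norm_natCast]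
  have h1 := (Complex.GammaSeq_tendsto_Gamma u).norm
  have h2 := ((Complex.GammaSeq_tendsto_Gamma (u + s)).norm).mul
    ((hlim.rpow_const (p := s) (Or.inl one_ne_zero)).const_mul (C * ‖u‖ ^ (-s)))
  have := le_of_tendsto_of_tendsto h1 h2
    (by filter_upwards [eventually_gt_atTop 0] with n hn using key n hn)
  simpa [mul_comm] using this

lemma norm_sin_le (w : ℂ) : ‖Complex.sin w‖ ≤ Real.exp |w.im| := by
  have h1 : ‖Complex.exp (-w * Complex.I)‖ ≤ Real.exp |w.im| := by
    rw [Complex.norm_exp]; simpa using le_abs_self _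
  have h2 : ‖Complex.exp (w * Complex.I)‖ ≤ Real.exp |w.im| := by
    rw [Complex.norm_exp]; simpa using neg_le_abs _
  have h3 := norm_sub_le (Complex.exp (-w * Complex.I)) (Complex.exp (w * Complex.I))
  rw [Complex.sin, norm_div, norm_mul, Complex.norm_I, mul_one]
  norm_num
  norm_num at h1 h2 h3
  linarith

lemma inv_Gamma_one_sub {u : ℂ} (h : Complex.Gamma u ≠ 0) :
    (Complex.Gamma (1 - u))⁻¹ = Complex.Gamma u * Complex.sin (Real.pi * u) / Real.pi := by
  have hr := Complex.Gamma_mul_Gamma_one_sub u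
  have hπ : (Real.pi : ℂ) ≠ 0 := by exact_mod_cast Real.pi_ne_zero
  by_cases hs : Complex.sin (Real.pi * u) = 0
  -- Here `π / 0 = 0` forces `Γ(1 - u) = 0`, the default value at a pole, so both sides vanish.
  · rw [hs, div_zero, mul_eq_zero] at hr
    rw [hs, hr.resolve_left h]
    simp
  · have h1 : Complex.Gamma (1 - u) ≠ 0 := fun h0 => by
      rw [h0, mul_zero, eq_comm, div_eq_zero_iff] at hr
      exact hr.elim hπ hs
    rw [eq_div_iff hs] at hr
    rw [eq_div_iff hπ, inv_mul_eq_iff_eq_mul₀ h1]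
    linear_combination -hr

lemma axisFactor_neg (R : ℝ) (z : ℂ) : axisFactor R (-z) = -axisFactor R z := by
  simp only [axisFactor, one_mul, neg_mul, neg_neg]
  ring

/-- With `u = z - R` and `s = 2R + 1` the two Gamma arguments are `u + s` and `1 - u`. Reflection
turns the product of reciprocals into `Γ(u) sin(πu) / (π Γ(u + s))`; the quotient is `O(‖u‖ ^
(-s))`, and the factor `z` raises the power to `-2R`. -/
lemma axisFactor_bound_of_far {R : ℝ} (hR : 0 < R) :
    ∃ C : ℝ, 0 < C ∧ ∀ z : ℂ, 0 ≤ z.re → (1 ≤ |z.im| ∨ R + 1 ≤ z.re) →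
      ‖axisFactor R z‖ ≤ C * Real.exp (Real.pi * |z.im|) * (1 + ‖z‖) ^ (-2 * R) := by
  set s : ℝ := 2 * R + 1
  have hs : 0 < s := by positivity
  -- For `j + 1 ≤ 2R + 3` the bound `‖u + j‖ ≥ 1` suffices; for larger `j` the real part is already
  -- at least `(j + 1) / 2`.
  set c : ℝ := 1 / (2 * R + 3)
  have hc : 0 < c := by positivity
  obtain ⟨C, hC, hΓ⟩ := norm_Gamma_le_norm_Gamma_add hs hc
  refine ⟨C * (2 + R) ^ s, by positivity, fun z hz hfar => ?_⟩
  set u : ℂ := z - R with hu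
  have hone : ∀ j : ℕ, 1 ≤ ‖u + j‖ := by
    intro j
    rcases hfar with h | h
    · have h1 := Complex.abs_im_le_norm (u + j)
      have h2 : (u + j).im = z.im := by simp [hu]
      rw [h2] at h1
      exact h.trans h1
    · have h1 := (le_abs_self _).trans (Complex.abs_re_le_norm (u + j))
      have h2 : (u + j).re = z.re - R + j := by simp [hu]
      rw [h2] at h1
      linarith [Nat.cast_nonneg (α := ℝ) j]
  have hbig : ∀ j : ℕ, c * (j + 1) ≤ ‖u + j‖ := by
    intro j
    rw [div_mul_eq_mul_div, one_mul, div_le_iff₀ (by positivity)]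
    by_cases hj : (j : ℝ) + 1 ≤ 2 * R + 3
    · nlinarith [hone j]
    · have h1 := (le_abs_self _).trans (Complex.abs_re_le_norm (u + j))
      have h2 : (u + j).re = z.re - R + j := by simp [hu]
      rw [h2] at h1
      push Not at hj
      have h3 : ((j : ℝ) + 1) / 2 ≤ ‖u + j‖ := by linarith
      nlinarith
  have hus : u + s = z + (1 + R) := by simp only [hu, s]; push_cast; ring
  have hre : 0 < (u + s).re := by rw [hus]; simp; linarith
  have hb := hΓ u hbig hre
  have hu1 : 1 ≤ ‖u‖ := by simpa using hone 0
  have hΓs : Complex.Gamma (u + s) ≠ 0 := Complex.Gamma_ne_zero_of_re_pos hre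
  have hΓu : Complex.Gamma u ≠ 0 := Complex.Gamma_ne_zero fun m h => by
    have := hone m
    rw [h] at this
    simp at this
    linarith
  have heq : axisFactor R z = z * ((Complex.Gamma (u + s))⁻¹ *
      (Complex.Gamma u * Complex.sin (Real.pi * u) / Real.pi)) := by
    rw [← inv_Gamma_one_sub hΓu, hus, axisFactor]
    rw [hu]
    ring_nf
  have hsin : ‖Complex.sin (Real.pi * u)‖ ≤ Real.exp (Real.pi * |z.im|) := by
    refine (norm_sin_le _).trans (le_of_eq ?_)
    simp [hu, abs_mul, abs_of_pos Real.pi_pos]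
  have hz1 : 1 + ‖z‖ ≤ (2 + R) * ‖u‖ := by
    have h1 : ‖z‖ ≤ ‖u‖ + R := by
      have : z = u + R := by simp [hu]
      calc ‖z‖ = ‖u + R‖ := by rw [← this]
        _ ≤ ‖u‖ + ‖(R : ℂ)‖ := norm_add_le _ _
        _ = _ := by rw [Complex.norm_real, Real.norm_of_nonneg hR.le]
    nlinarith
  have hu2 : ‖u‖ ^ (-s) ≤ (2 + R) ^ s * (1 + ‖z‖) ^ (-s) := by
    have h1 : (1 + ‖z‖) ^ s ≤ (2 + R) ^ s * ‖u‖ ^ s := by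
      rw [← Real.mul_rpow (by positivity) (by positivity)]
      exact Real.rpow_le_rpow (by positivity) hz1 hs.le
    rw [Real.rpow_neg (by positivity), Real.rpow_neg (by positivity), ← div_eq_mul_inv,
      le_div_iff₀ (by positivity), inv_mul_le_iff₀ (by positivity)]
    linarith
  have hΓpos : 0 < ‖Complex.Gamma (u + s)‖ := norm_pos_iff.2 hΓs
  rw [heq, norm_mul, norm_mul, norm_div, norm_mul, norm_inv, Complex.norm_real,
    Real.norm_of_nonneg Real.pi_pos.le]
  have hπ1 : 1 ≤ Real.pi := by linarith [Real.pi_gt_three]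
  calc ‖z‖ * (‖Complex.Gamma (u + s)‖⁻¹ *
        (‖Complex.Gamma u‖ * ‖Complex.sin (Real.pi * u)‖ / Real.pi))
      ≤ (1 + ‖z‖) * (‖Complex.Gamma (u + s)‖⁻¹ *
        ((C * ((2 + R) ^ s * (1 + ‖z‖) ^ (-s)) * ‖Complex.Gamma (u + s)‖) *
          Real.exp (Real.pi * |z.im|) / 1)) := by
        gcongr
        · linarith
        · refine hb.trans ?_
          gcongr
    _ = C * (2 + R) ^ s * Real.exp (Real.pi * |z.im|) * ((1 + ‖z‖) * (1 + ‖z‖) ^ (-s)) := by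
        field_simp
    _ = _ := by
        rw [← Real.rpow_one_add' (by positivity) (by simp only [s]; linarith)]
        congr 2
        simp only [s]
        ring

lemma axisFactor_bound {R : ℝ} (hR : 0 < R) :
    ∃ C : ℝ, 0 < C ∧ ∀ z : ℂ,
      ‖axisFactor R z‖ ≤ C * Real.exp (Real.pi * |z.im|) * (1 + ‖z‖) ^ (-2 * R) := by
  obtain ⟨C, hC, hfar⟩ := axisFactor_bound_of_far hR
  obtain ⟨B, hB⟩ := (isCompact_closedBall (0 : ℂ) (R + 2)).exists_bound_of_continuousOn
    (differentiable_axisFactor R).continuous.continuousOn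
  have hB0 : 0 ≤ B := (norm_nonneg _).trans (hB 0 (by simp; linarith))
  have hhalf : ∀ z : ℂ, 0 ≤ z.re → ‖axisFactor R z‖ ≤
      (C + B * (R + 3) ^ (2 * R)) * Real.exp (Real.pi * |z.im|) * (1 + ‖z‖) ^ (-2 * R) := by
    intro z hz
    by_cases h : 1 ≤ |z.im| ∨ R + 1 ≤ z.re
    · refine (hfar z hz h).trans ?_
      gcongr
      have : 0 ≤ B * (R + 3) ^ (2 * R) := by positivity
      linarith
    · push Not at h
      have hn : ‖z‖ ≤ R + 2 := by
        have := Complex.norm_le_abs_re_add_abs_im z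
        rw [abs_of_nonneg hz] at this
        linarith
      have h1 : (1 + ‖z‖) ^ (2 * R) ≤ (R + 3) ^ (2 * R) :=
        Real.rpow_le_rpow (by positivity) (by linarith) (by positivity)
      have h2 : 1 ≤ Real.exp (Real.pi * |z.im|) := Real.one_le_exp (by positivity)
      have h3 : 1 ≤ (R + 3) ^ (2 * R) * (1 + ‖z‖) ^ (-2 * R) := by
        rw [neg_mul, Real.rpow_neg (by positivity), ← div_eq_mul_inv, one_le_div (by positivity)]
        exact h1
      calc ‖axisFactor R z‖ ≤ B * 1 * 1 := by simpa using hB z (by simpa using hn)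
        _ ≤ B * Real.exp (Real.pi * |z.im|) *
            ((R + 3) ^ (2 * R) * (1 + ‖z‖) ^ (-2 * R)) := by gcongr
        _ = (0 + B * (R + 3) ^ (2 * R)) * Real.exp (Real.pi * |z.im|) * (1 + ‖z‖) ^ (-2 * R) := by
          ring
        _ ≤ _ := by gcongr
  refine ⟨C + B * (R + 3) ^ (2 * R), by positivity, fun z => ?_⟩
  rcases le_total 0 z.re with hz | hz
  · exact hhalf z hz
  · have := hhalf (-z) (by simpa using hz)
    rwa [axisFactor_neg, norm_neg, norm_neg, Complex.neg_im, abs_neg] at this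

/-! ### Growth of the row product, and membership in the Fock space. -/

lemma norm_rowProduct_le_of_im_ge {z : ℂ} (h : -1 ≤ z.im) :
    ‖rowProduct z‖ ≤ Real.exp (Real.exp (2 * Real.pi) * ∑' n : ℕ, Real.exp (-2 * Real.pi) ^ (n + 1)) := by
  have hs := summable_norm_rowTerm z
  have hm : Multipliable fun n => 1 + rowTerm n z := multipliable_one_add_of_summable hs
  refine le_of_tendsto hm.hasProd.norm (Eventually.of_forall fun s => ?_)
  calc ∏ n ∈ s, ‖1 + rowTerm n z‖ ≤ ∏ n ∈ s, Real.exp ‖rowTerm n z‖ := by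
        refine Finset.prod_le_prod (fun _ _ => norm_nonneg _) fun n _ => ?_
        have h1 := norm_add_le 1 (rowTerm n z)
        rw [norm_one] at h1
        linarith [Real.add_one_le_exp ‖rowTerm n z‖]
    _ = Real.exp (∑ n ∈ s, ‖rowTerm n z‖) := (Real.exp_sum _ _).symm
    _ ≤ _ := by
        refine Real.exp_le_exp.2 ((hs.sum_le_tsum s fun _ _ => norm_nonneg _).trans ?_)
        simp only [norm_rowTerm]
        rw [tsum_mul_left]
        exact mul_le_mul_of_nonneg_right (Real.exp_le_exp.2 (by nlinarith [Real.pi_pos]))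
          (tsum_nonneg fun _ => by positivity)

lemma rowProduct_bound_lower :
    ∃ C : ℝ, 0 < C ∧ ∀ z : ℂ, z.im ≤ 0 →
      ‖rowProduct z‖ ≤ C * Real.exp (Real.pi * z.im ^ 2 + Real.pi * z.im) := by
  set M := Real.exp (Real.exp (2 * Real.pi) * ∑' n : ℕ, Real.exp (-2 * Real.pi) ^ (n + 1))
  have hM : 0 < M := Real.exp_pos _
  have hq : Real.exp (-2 * Real.pi) ≤ 1 / 2 := by
    have h1 := Real.add_one_le_exp (2 * Real.pi)
    have h2 : (2 : ℝ) ≤ Real.exp (2 * Real.pi) := by linarith [Real.pi_gt_three]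
    rw [neg_mul, Real.exp_neg, ← one_div]
    exact one_div_le_one_div_of_le two_pos h2
  -- Induction on strips through `rowProduct_eq`. The quadratic exponent reproduces itself exactly
  -- under `y ↦ y + 1`. The extra term `-2 exp (2πy)` absorbs the error `exp x` of each step,
  -- because `exp (2πy) ≤ x / 2`.
  have key : ∀ N : ℕ, ∀ z : ℂ, z.im ≤ 0 → -1 - (N : ℝ) ≤ z.im → ‖rowProduct z‖ ≤
      M * Real.exp (Real.pi + 2) *
        Real.exp (Real.pi * z.im ^ 2 + Real.pi * z.im - 2 * Real.exp (2 * Real.pi * z.im)) := by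
    intro N
    induction N with
    | zero =>
      intro z hz hz1
      refine (norm_rowProduct_le_of_im_ge (by simpa using hz1)).trans ?_
      rw [mul_assoc, ← Real.exp_add]
      refine le_mul_of_one_le_right hM.le (Real.one_le_exp ?_)
      have h1 : Real.exp (2 * Real.pi * z.im) ≤ 1 :=
        Real.exp_le_one_iff.2 (by nlinarith [Real.pi_pos])
      have h2 : -1 ≤ z.im := by simpa using hz1
      nlinarith [Real.pi_pos, mul_nonneg Real.pi_pos.le (sq_nonneg z.im)]
    | succ N ih =>
      intro z hz hz1
      by_cases hz2 : -1 - (N : ℝ) ≤ z.im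
      · exact ih z hz hz2
      have hz3 : z.im + 1 ≤ 0 := by linarith [Nat.cast_nonneg (α := ℝ) N]
      have him : (1 * z + Complex.I).im = z.im + 1 := by simp
      push_cast at hz1
      have h1 := ih (1 * z + Complex.I) (by rw [him]; exact hz3) (by rw [him]; linarith)
      rw [him] at h1
      rw [rowProduct_eq, norm_mul]
      set x := Real.exp (2 * Real.pi * (z.im + 1)) with hx
      have hx0 : 0 < x := Real.exp_pos _
      have h2 : ‖1 + rowTerm 0 z‖ ≤ x⁻¹ * Real.exp x := by
        have h3 := norm_add_le 1 (rowTerm 0 z)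
        have h4 : ‖rowTerm 0 z‖ = x⁻¹ := by
          rw [norm_rowTerm, hx, ← Real.exp_neg, zero_add, pow_one, ← Real.exp_add]
          congr 1; ring
        rw [norm_one, h4] at h3
        refine h3.trans ?_
        rw [← div_eq_inv_mul, le_div_iff₀ hx0, add_mul, inv_mul_cancel₀ hx0.ne', one_mul]
        exact Real.add_one_le_exp x
      have h5 : Real.exp (2 * Real.pi * z.im) ≤ x / 2 := by
        have : Real.exp (2 * Real.pi * z.im) = x * Real.exp (-2 * Real.pi) := by
          rw [hx, ← Real.exp_add]; congr 1; ring
        rw [this]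
        nlinarith
      calc _ ≤ x⁻¹ * Real.exp x * (M * Real.exp (Real.pi + 2) *
            Real.exp (Real.pi * (z.im + 1) ^ 2 + Real.pi * (z.im + 1) - 2 * x)) :=
            mul_le_mul h2 h1 (norm_nonneg _) (by positivity)
        _ = M * Real.exp (Real.pi + 2) * (x⁻¹ * Real.exp x *
            Real.exp (Real.pi * (z.im + 1) ^ 2 + Real.pi * (z.im + 1) - 2 * x)) := by ring
        _ ≤ _ := by
          refine mul_le_mul_of_nonneg_left ?_ (by positivity)
          rw [hx, ← Real.exp_neg, ← hx, ← Real.exp_add, ← Real.exp_add, Real.exp_le_exp]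
          nlinarith
  refine ⟨M * Real.exp (Real.pi + 2), by positivity, fun z hz => ?_⟩
  obtain ⟨N, hN⟩ := exists_nat_ge (-1 - z.im)
  refine (key N z hz (by linarith)).trans ?_
  gcongr
  linarith [Real.exp_pos (2 * Real.pi * z.im)]

lemma rowProduct_mul_bound :
    ∃ C : ℝ, 0 < C ∧ ∀ z : ℂ,
      ‖rowProduct z * rowProduct (-z)‖ ≤ C * Real.exp (Real.pi * z.im ^ 2 - Real.pi * |z.im|) := by
  obtain ⟨C, hC, h⟩ := rowProduct_bound_lower
  set M := Real.exp (Real.exp (2 * Real.pi) * ∑' n : ℕ, Real.exp (-2 * Real.pi) ^ (n + 1))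
  have hM : 0 < M := Real.exp_pos _
  have key : ∀ z : ℂ, z.im ≤ 0 → ‖rowProduct z * rowProduct (-z)‖ ≤
      C * M * Real.exp (Real.pi * z.im ^ 2 - Real.pi * |z.im|) := by
    intro z hz
    have h1 := h z hz
    have h2 := norm_rowProduct_le_of_im_ge (z := -z) (by rw [Complex.neg_im]; linarith)
    rw [norm_mul]
    calc _ ≤ _ := mul_le_mul h1 h2 (norm_nonneg _) (by positivity)
      _ = _ := by rw [abs_of_nonpos hz, mul_neg, sub_neg_eq_add, mul_right_comm]
  refine ⟨C * M, by positivity, fun z => ?_⟩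
  rcases le_total z.im 0 with hz | hz
  · exact key z hz
  · have := key (-z) (by simpa using hz)
    rwa [neg_neg, mul_comm (rowProduct _), Complex.neg_im, abs_neg, neg_sq] at this

/-- The exponents `π(x² - y²)/2` of the Gaussian factor, `π|y|` of the axis and `πy² - π|y|` of the
rows add up to `π(x² + y²)/2`. -/
lemma latticeFunction_bound {R : ℝ} (hR : 0 < R) :
    ∃ C : ℝ, 0 < C ∧ ∀ z : ℂ,
      ‖latticeFunction R z‖ ≤ C * (1 + ‖z‖) ^ (-2 * R) * Real.exp (Real.pi / 2 * ‖z‖ ^ 2) := by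
  obtain ⟨C, hC, h1⟩ := axisFactor_bound hR
  obtain ⟨D, hD, h2⟩ := rowProduct_mul_bound
  refine ⟨C * D, by positivity, fun z => ?_⟩
  have h3 : ‖Complex.exp (Real.pi / 2 * z ^ 2)‖ =
      Real.exp (Real.pi / 2 * (z.re ^ 2 - z.im ^ 2)) := by
    rw [Complex.norm_exp]
    congr 1
    have : (Real.pi / 2 * z ^ 2 : ℂ) = ((Real.pi / 2 : ℝ) : ℂ) * z ^ 2 := by push_cast; ring
    rw [this, Complex.re_ofReal_mul, pow_two z, Complex.mul_re]
    ring
  have h4 : ‖z‖ ^ 2 = z.re ^ 2 + z.im ^ 2 := by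
    rw [← Complex.normSq_eq_norm_sq, Complex.normSq_apply]; ring
  have h5 := h2 z
  rw [latticeFunction, norm_mul, norm_mul, h3]
  simp only [one_mul, add_zero, neg_mul (1 : ℂ)]
  calc _ ≤ Real.exp (Real.pi / 2 * (z.re ^ 2 - z.im ^ 2)) *
        ((C * Real.exp (Real.pi * |z.im|) * (1 + ‖z‖) ^ (-2 * R)) *
          (D * Real.exp (Real.pi * z.im ^ 2 - Real.pi * |z.im|))) := by
        refine mul_le_mul_of_nonneg_left ?_ (Real.exp_pos _).le
        exact mul_le_mul (h1 z) h5 (norm_nonneg _) (by positivity)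
    _ = C * D * (1 + ‖z‖) ^ (-2 * R) * (Real.exp (Real.pi / 2 * (z.re ^ 2 - z.im ^ 2)) *
          Real.exp (Real.pi * |z.im|) * Real.exp (Real.pi * z.im ^ 2 - Real.pi * |z.im|)) := by ring
    _ = _ := by
        rw [← Real.exp_add, ← Real.exp_add, h4]
        congr 2
        ring

lemma isFockZeroSet_shiftedLattice {a R p : ℝ} (ha : 0 < a) (hp : 0 < p) (hR : 1 / p < R) :
    IsFockZeroSet (Real.pi / a ^ 2) p (shiftedLattice a R) := by
  have hR0 : 0 < R := lt_trans (by positivity) hR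
  obtain ⟨C, hC, hb⟩ := latticeFunction_bound hR0
  set f : ℂ → ℂ := fun w => latticeFunction R ((a : ℂ)⁻¹ * w + 0) with hf
  have hdiff : Differentiable ℂ f := (differentiable_latticeFunction R).comp
    (by fun_prop : Differentiable ℂ fun w : ℂ => (a : ℂ)⁻¹ * w + 0)
  have hord := fun z => analyticOrderAt_eq_encard ha hR0 z
  refine ⟨f, ⟨hdiff, ?_⟩, ?_, hord⟩
  · set β : ℝ := p * (Real.pi / a ^ 2) / 2 with hβ
    -- The decay exponent `2 R p` must exceed the real dimension `2`; this is `1 / p < R`.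
    have hint : Integrable (fun z : ℂ => (1 + ‖z‖) ^ (-(2 * R * p))) := by
      refine integrable_one_add_norm ?_
      rw [Complex.finrank_real_complex]
      rw [div_lt_iff₀ hp] at hR
      push_cast
      linarith
    have hint2 : Integrable (fun z : ℂ => C ^ p * (β / Real.pi) * (1 + ‖a⁻¹ • z‖) ^ (-(2 * R * p))) :=
      (hint.comp_smul (inv_ne_zero ha.ne')).const_mul _
    rw [gaussianArea, lintegral_withDensity_eq_lintegral_mul₀ (by fun_prop)
      (by have := hdiff.continuous; fun_prop)]
    refine lt_of_le_of_lt (lintegral_mono fun z => ?_) hint2.lintegral_lt_top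
    simp only [Pi.mul_apply]
    rw [← ofReal_norm, ENNReal.ofReal_rpow_of_nonneg (norm_nonneg _) hp.le,
      ← ENNReal.ofReal_mul (by positivity)]
    refine ENNReal.ofReal_le_ofReal ?_
    have hz : ((a : ℂ)⁻¹ * z + 0) = a⁻¹ • z := by
      rw [add_zero, Complex.real_smul, Complex.ofReal_inv]
    have h1 : ‖f z‖ ^ p ≤
        (C * (1 + ‖a⁻¹ • z‖) ^ (-2 * R) * Real.exp (Real.pi / 2 * ‖a⁻¹ • z‖ ^ 2)) ^ p := by
      refine Real.rpow_le_rpow (norm_nonneg _) ?_ hp.le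
      simp only [hf, hz]
      exact hb _
    rw [Real.mul_rpow (by positivity) (by positivity), Real.mul_rpow (by positivity) (by positivity),
      ← Real.rpow_mul (by positivity), ← Real.exp_mul] at h1
    have h2 : Real.pi / 2 * ‖a⁻¹ • z‖ ^ 2 * p = β * ‖z‖ ^ 2 := by
      rw [norm_smul, norm_inv, Real.norm_of_nonneg ha.le, hβ]
      field_simp
    rw [h2] at h1
    calc _ ≤ β / Real.pi * Real.exp (-β * ‖z‖ ^ 2) *
          (C ^ p * (1 + ‖a⁻¹ • z‖) ^ (-2 * R * p) * Real.exp (β * ‖z‖ ^ 2)) := by gcongr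
      _ = C ^ p * (β / Real.pi) * (1 + ‖a⁻¹ • z‖) ^ (-2 * R * p) *
          (Real.exp (-β * ‖z‖ ^ 2) * Real.exp (β * ‖z‖ ^ 2)) := by ring
      _ = _ := by
          rw [← Real.exp_add, neg_mul β, neg_add_cancel, Real.exp_zero, mul_one]
          congr 2
          ring
  -- The zero function has order `⊤` at `0`, whereas injectivity allows at most one index there.
  · intro h0
    have h1 := hord 0
    have h2 : analyticOrderAt f 0 = ⊤ := by
      rw [h0]; exact analyticOrderAt_eq_top.2 (Eventually.of_forall fun _ => rfl)
    rw [← hf, h2] at h1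
    have h3 : {k | shiftedLattice a R k = 0}.Subsingleton := fun k hk l hl =>
      shiftedLattice_injective ha hR0.le (hk.trans hl.symm)
    have h4 := Set.encard_le_one_iff_subsingleton.2 h3
    rw [← h1] at h4
    simp at h4

/-! ### Integrals of the logarithm over squares and disks. -/

/-- The closed unit square centered at the origin. -/
def unitSquare : Set ℂ := Set.Icc (-(1 / 2 : ℝ)) (1 / 2) ×ℂ Set.Icc (-(1 / 2 : ℝ)) (1 / 2)

lemma isCompact_unitSquare : IsCompact unitSquare := isCompact_Icc.reProdIm isCompact_Icc

lemma measurableSet_unitSquare : MeasurableSet unitSquare := isCompact_unitSquare.isClosed.measurableSet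

lemma volume_unitSquare : volume unitSquare = 1 := by
  rw [unitSquare, volume_reProdIm, Real.volume_Icc, ← ENNReal.ofReal_mul (by norm_num)]
  norm_num

lemma mem_unitSquare {w : ℂ} : w ∈ unitSquare ↔ |w.re| ≤ 1 / 2 ∧ |w.im| ≤ 1 / 2 := by
  simp [unitSquare, Complex.mem_reProdIm, abs_le]

lemma norm_sq_le_of_mem_unitSquare {w : ℂ} (hw : w ∈ unitSquare) : ‖w‖ ^ 2 ≤ 1 / 2 := by
  obtain ⟨h1, h2⟩ := mem_unitSquare.1 hw
  rw [← Complex.normSq_eq_norm_sq, Complex.normSq_apply]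
  nlinarith [abs_nonneg w.re, abs_nonneg w.im, sq_abs w.re, sq_abs w.im]

lemma norm_lt_one_of_mem_unitSquare {w : ℂ} (hw : w ∈ unitSquare) : ‖w‖ < 1 := by
  nlinarith [norm_sq_le_of_mem_unitSquare hw, norm_nonneg w]

lemma setIntegral_unitSquare_I_mul (g : ℂ → ℝ) :
    ∫ w in unitSquare, g (Complex.I * w) = ∫ w in unitSquare, g w := by
  let e : ℂ ≃ₗᵢ[ℝ] ℂ := rotation ⟨Complex.I, by simp [Submonoid.unitSphere]⟩
  have he : ∀ w, e w = Complex.I * w := fun w => rfl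
  have hpre : e ⁻¹' unitSquare = unitSquare := by
    ext w
    rw [Set.mem_preimage, he, mem_unitSquare, mem_unitSquare]
    simp [and_comm]
  have := (LinearIsometryEquiv.measurePreserving e).setIntegral_preimage_emb
    e.toHomeomorph.measurableEmbedding g unitSquare
  rw [hpre] at this
  exact this

lemma continuousOn_log_norm_add {v : ℂ} (hv : 1 ≤ ‖v‖) (c : ℂ) (hc : ‖c‖ = 1) :
    ContinuousOn (fun w => Real.log ‖v + c * w‖) unitSquare := by
  refine ContinuousOn.log (by fun_prop) fun w hw h => ?_
  rw [norm_eq_zero] at h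
  have h1 : ‖v‖ = ‖w‖ := by
    rw [eq_neg_of_add_eq_zero_left h, norm_neg, norm_mul, hc, one_mul]
  linarith [norm_lt_one_of_mem_unitSquare hw]

/-- The mean value of `log ‖·‖` over a unit square centered at `v` almost exceeds `log ‖v‖`. -/
lemma le_setIntegral_log_norm_add {v : ℂ} (hv : 1 ≤ ‖v‖) :
    Real.log ‖v‖ - 1 / ‖v‖ ^ 4 ≤ ∫ w in unitSquare, Real.log ‖v + w‖ := by
  have hv0 : 0 < ‖v‖ := by linarith
  have hi : ∀ c : ℂ, ‖c‖ = 1 → IntegrableOn (fun w => Real.log ‖v + c * w‖) unitSquare :=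
    fun c hc => (continuousOn_log_norm_add hv c hc).integrableOn_compact isCompact_unitSquare
  have h0 : ∫ w in unitSquare, Real.log ‖v + 1 * w‖ = ∫ w in unitSquare, Real.log ‖v + w‖ := by
    simp
  have h1 : ∫ w in unitSquare, Real.log ‖v + Complex.I * w‖ =
      ∫ w in unitSquare, Real.log ‖v + w‖ :=
    setIntegral_unitSquare_I_mul fun w => Real.log ‖v + w‖
  have h2 : ∫ w in unitSquare, Real.log ‖v + (-1) * w‖ =
      ∫ w in unitSquare, Real.log ‖v + w‖ := by
    rw [← h1, ← setIntegral_unitSquare_I_mul fun w => Real.log ‖v + Complex.I * w‖]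
    simp only [← mul_assoc, Complex.I_mul_I]
  have h3 : ∫ w in unitSquare, Real.log ‖v + (-Complex.I) * w‖ =
      ∫ w in unitSquare, Real.log ‖v + w‖ := by
    rw [← h2, ← setIntegral_unitSquare_I_mul fun w => Real.log ‖v + (-1) * w‖]
    simp only [neg_mul, one_mul]
  have i0 := hi 1 (by simp)
  have i1 := hi Complex.I (by simp)
  have i2 := hi (-1) (by simp)
  have i3 := hi (-Complex.I) (by simp)
  have i01 : IntegrableOn (fun w => Real.log ‖v + 1 * w‖ + Real.log ‖v + Complex.I * w‖)
      unitSquare := i0.add i1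
  have i23 : IntegrableOn (fun w => Real.log ‖v + (-1) * w‖ + Real.log ‖v + (-Complex.I) * w‖)
      unitSquare := i2.add i3
  -- Averaging over the four rotations of the square replaces `v + w` by the product of the `v + iʲ
  -- w`, which is `v⁴ - w⁴`. The error is therefore `O(‖v‖⁻⁴)`, summable over the Gaussian integers.
  have hsum : 4 * ∫ w in unitSquare, Real.log ‖v + w‖ =
      ∫ w in unitSquare, ((Real.log ‖v + 1 * w‖ + Real.log ‖v + Complex.I * w‖) +
        (Real.log ‖v + (-1) * w‖ + Real.log ‖v + (-Complex.I) * w‖)) := by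
    rw [integral_add i01 i23, integral_add i0 i1, integral_add i2 i3,
      h0, h1, h2, h3]
    ring
  have hvol : volume.real unitSquare = 1 := by simp [Measure.real, volume_unitSquare]
  have hconst : ∫ _ in unitSquare, (4 * Real.log ‖v‖ - 1 / ‖v‖ ^ 4) =
      4 * Real.log ‖v‖ - 1 / ‖v‖ ^ 4 := by
    rw [setIntegral_const, hvol, one_smul]
  have hle : ∫ _ in unitSquare, (4 * Real.log ‖v‖ - 1 / ‖v‖ ^ 4) ≤
      ∫ w in unitSquare, ((Real.log ‖v + 1 * w‖ + Real.log ‖v + Complex.I * w‖) +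
        (Real.log ‖v + (-1) * w‖ + Real.log ‖v + (-Complex.I) * w‖)) := by
    refine setIntegral_mono_on (integrableOn_const (by simp [volume_unitSquare]))
      (i01.add i23) measurableSet_unitSquare fun w hw => ?_
    have hw2 := norm_sq_le_of_mem_unitSquare hw
    have hne : ∀ c : ℂ, ‖c‖ = 1 → ‖v + c * w‖ ≠ 0 := fun c hc h => by
      rw [norm_eq_zero] at h
      have h1 : ‖v‖ = ‖w‖ := by
        rw [eq_neg_of_add_eq_zero_left h, norm_neg, norm_mul, hc, one_mul]
      linarith [norm_lt_one_of_mem_unitSquare hw]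
    have n0 := hne 1 (by simp)
    have n1 := hne Complex.I (by simp)
    have n2 := hne (-1) (by simp)
    have n3 := hne (-Complex.I) (by simp)
    rw [← Real.log_mul n0 n1, ← Real.log_mul n2 n3,
      ← Real.log_mul (mul_ne_zero n0 n1) (mul_ne_zero n2 n3), ← norm_mul, ← norm_mul, ← norm_mul]
    have hprod : (v + 1 * w) * (v + Complex.I * w) * ((v + (-1) * w) * (v + (-Complex.I) * w)) =
        v ^ 4 - w ^ 4 := by
      linear_combination (-(v ^ 2 * w ^ 2) + w ^ 4) * Complex.I_sq
    rw [hprod]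
    have hw4 : ‖w‖ ^ 4 ≤ 1 / 4 := by nlinarith [sq_nonneg ‖w‖]
    have hv4 : 1 ≤ ‖v‖ ^ 4 := one_le_pow₀ hv
    have hlow : ‖v‖ ^ 4 * (1 - 1 / (4 * ‖v‖ ^ 4)) ≤ ‖v ^ 4 - w ^ 4‖ := by
      have := norm_sub_norm_le (v ^ 4) (w ^ 4)
      rw [norm_pow, norm_pow] at this
      have h4 : ‖v‖ ^ 4 * (1 - 1 / (4 * ‖v‖ ^ 4)) = ‖v‖ ^ 4 - 1 / 4 := by field_simp
      linarith
    have hx : 1 / (4 * ‖v‖ ^ 4) ≤ 1 / 4 := one_div_le_one_div_of_le (by norm_num) (by linarith)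
    have hx0 : 0 < 1 / (4 * ‖v‖ ^ 4) := by positivity
    have hx4 : 1 / ‖v‖ ^ 4 = 4 * (1 / (4 * ‖v‖ ^ 4)) := by field_simp
    rw [hx4]
    set x := 1 / (4 * ‖v‖ ^ 4)
    have hlog : -(4 * x) ≤ Real.log (1 - x) := by
      have h5 := Real.one_sub_inv_le_log_of_pos (by linarith : 0 < 1 - x)
      have h6 : (1 - x)⁻¹ ≤ 1 + 4 * x := by
        rw [inv_le_iff_one_le_mul₀ (by linarith)]
        nlinarith
      linarith
    have := Real.log_le_log (by nlinarith) hlow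
    rw [Real.log_mul (by positivity) (by linarith), Real.log_pow] at this
    push_cast at this
    linarith
  have h4 : 0 < 1 / ‖v‖ ^ 4 := by positivity
  linarith

lemma integral_mul_log_div {r ρ : ℝ} (hρ : 0 < ρ) (hr : 0 < r) :
    IntegrableOn (fun t => t * Real.log (r / t)) (Set.Ioo 0 ρ) ∧
    ∫ t in Set.Ioo 0 ρ, t * Real.log (r / t) = ρ ^ 2 / 2 * Real.log (r / ρ) + ρ ^ 2 / 4 := by
  have hc : Continuous fun t : ℝ => t * Real.log r - t * Real.log t :=
    (by fun_prop : Continuous fun t : ℝ => t * Real.log r).sub Real.continuous_mul_log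
  have heq : Set.EqOn (fun t => t * Real.log (r / t)) (fun t => t * Real.log r - t * Real.log t)
      (Set.Ioo 0 ρ) := fun t ht => by
    simp only
    rw [Real.log_div hr.ne' ht.1.ne']
    ring
  have hi : IntegrableOn (fun t => t * Real.log r - t * Real.log t) (Set.Ioo 0 ρ) :=
    (hc.integrableOn_Icc (a := 0) (b := ρ)).mono_set Set.Ioo_subset_Icc_self
  refine ⟨hi.congr_fun heq.symm measurableSet_Ioo, ?_⟩
  rw [setIntegral_congr_fun measurableSet_Ioo heq, ← integral_Ioc_eq_integral_Ioo,
    ← intervalIntegral.integral_of_le hρ.le,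
    intervalIntegral.integral_eq_sub_of_hasDerivAt_of_le
      (f := fun t => t ^ 2 / 2 * Real.log r - t / 2 * (t * Real.log t) + t ^ 2 / 4) hρ.le ?_ ?_
      (hc.intervalIntegrable _ _)]
  · rw [Real.log_div hr.ne' hρ.ne']
    ring
  · have := Real.continuous_mul_log
    fun_prop
  · intro t ht
    have h1 := Real.hasDerivAt_mul_log ht.1.ne'
    have h2 : HasDerivAt (fun t => t / 2 * (t * Real.log t))
        (1 / 2 * (t * Real.log t) + t / 2 * (Real.log t + 1)) t :=
      ((hasDerivAt_id t).div_const 2).mul h1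
    have h3 : HasDerivAt (fun t : ℝ => t ^ 2 / 2 * Real.log r) (2 * t / 2 * Real.log r) t := by
      simpa using ((hasDerivAt_pow 2 t).div_const 2).mul_const (Real.log r)
    have h4 : HasDerivAt (fun t : ℝ => t ^ 2 / 4) (2 * t / 4) t := by
      simpa using (hasDerivAt_pow 2 t).div_const 4
    have h5 := (h3.sub h2).add h4
    have e : 2 * t / 2 * Real.log r - (1 / 2 * (t * Real.log t) + t / 2 * (Real.log t + 1)) +
        2 * t / 4 = t * Real.log r - t * Real.log t := by ring
    rw [e] at h5
    exact h5

lemma integral_ball_log_div {r ρ : ℝ} (hρ : 0 < ρ) (hr : 0 < r) :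
    IntegrableOn (fun z : ℂ => Real.log (r / ‖z‖)) (Metric.ball 0 ρ) ∧
    ∫ z in Metric.ball (0 : ℂ) ρ, Real.log (r / ‖z‖) =
      Real.pi * (ρ ^ 2 * Real.log (r / ρ) + ρ ^ 2 / 2) := by
  obtain ⟨h1, h2⟩ := integral_mul_log_div hρ hr
  refine ⟨?_, ?_⟩
  · refine (integrableOn_fun_norm_addHaar (volume : Measure ℂ)
      (f := fun t => Real.log (r / t))).2 ?_
    simpa [Complex.finrank_real_complex] using h1
  · have h3 := integral_fun_norm_addHaar (volume : Measure ℂ)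
      ((Set.Iio ρ).indicator fun t => Real.log (r / t))
    have h4 : (fun z : ℂ => (Set.Iio ρ).indicator (fun t => Real.log (r / t)) ‖z‖) =
        (Metric.ball (0 : ℂ) ρ).indicator fun z => Real.log (r / ‖z‖) := by
      ext z
      by_cases h : ‖z‖ < ρ <;> simp [h]
    have h5 : ∀ y : ℝ, y ^ 1 • (Set.Iio ρ).indicator (fun t => Real.log (r / t)) y =
        (Set.Iio ρ).indicator (fun t => t * Real.log (r / t)) y := by
      intro y
      by_cases h : y < ρ <;> simp [h]
    rw [h4, integral_indicator measurableSet_ball, Complex.finrank_real_complex] at h3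
    simp only [Nat.reduceSub, h5] at h3
    rw [setIntegral_indicator measurableSet_Iio, Set.Ioi_inter_Iio, h2] at h3
    rw [h3]
    have hv : volume.real (Metric.ball (0 : ℂ) 1) = Real.pi := by
      simp [Measure.real, Complex.volume_ball]
    rw [hv]
    simp only [nsmul_eq_mul, smul_eq_mul]
    push_cast
    ring

/-! ### Lower bounds for the lattice sums in Jensen's formula. -/

/-- The Gaussian integer with coordinates `k`. -/
noncomputable def gaussPoint (k : ℤ × ℤ) : ℂ := (k.1 : ℂ) + Complex.I * (k.2 : ℂ)

lemma norm_sq_gaussPoint (k : ℤ × ℤ) : ‖gaussPoint k‖ ^ 2 = (k.1 : ℝ) ^ 2 + (k.2 : ℝ) ^ 2 := by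
  rw [← Complex.normSq_eq_norm_sq, Complex.normSq_apply]
  simp [gaussPoint]
  ring

lemma one_le_norm_gaussPoint {k : ℤ × ℤ} (hk : k ≠ 0) : 1 ≤ ‖gaussPoint k‖ := by
  have h1 : 1 ≤ k.1 ^ 2 + k.2 ^ 2 := by
    by_contra! h
    have h1 : k.1 = 0 := by nlinarith [sq_nonneg k.1, sq_nonneg k.2]
    have h2 : k.2 = 0 := by nlinarith [sq_nonneg k.1, sq_nonneg k.2]
    exact hk (Prod.ext h1 h2)
  have h2 : (1 : ℝ) ≤ ‖gaussPoint k‖ ^ 2 := by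
    rw [norm_sq_gaussPoint]; exact_mod_cast h1
  nlinarith [norm_nonneg (gaussPoint k)]

lemma summable_inv_norm_gaussPoint_pow : Summable fun k : ℤ × ℤ => 1 / ‖gaussPoint k‖ ^ 4 := by
  have h1 : Summable fun m : ℤ => 3 / (1 + (m : ℝ) ^ 2) := by
    have h2 : Summable fun m : ℤ => 1 / (m : ℝ) ^ 2 := Real.summable_one_div_int_pow.2 one_lt_two
    refine Summable.of_norm_bounded_eventually (h2.mul_left 3) ?_
    have h0 : {m : ℤ | ¬‖3 / (1 + (m : ℝ) ^ 2)‖ ≤ 3 * (1 / (m : ℝ) ^ 2)} ⊆ {0} := by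
      intro m hm
      by_contra hm0
      have hm1 : (m : ℝ) ≠ 0 := by exact_mod_cast hm0
      refine hm ?_
      rw [Real.norm_of_nonneg (by positivity), mul_one_div]
      exact div_le_div_of_nonneg_left (by norm_num) (by positivity) (by linarith)
    exact (Set.finite_singleton (0 : ℤ)).subset h0
  refine Summable.of_nonneg_of_le (fun k => by positivity) (fun k => ?_)
    (h1.mul_of_nonneg h1 (fun m => by positivity) fun m => by positivity)
  by_cases hk : k = 0
  · subst hk
    have : gaussPoint 0 = 0 := by simp [gaussPoint]
    rw [this]
    simp
  · have h2 := one_le_norm_gaussPoint hk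
    have h3 : ‖gaussPoint k‖ ^ 4 = ((k.1 : ℝ) ^ 2 + (k.2 : ℝ) ^ 2) ^ 2 := by
      rw [← norm_sq_gaussPoint]; ring
    have h4 : 1 ≤ (k.1 : ℝ) ^ 2 + (k.2 : ℝ) ^ 2 := by
      rw [← norm_sq_gaussPoint]; exact one_le_pow₀ h2
    rw [h3, div_mul_div_comm, div_le_div_iff₀ (by positivity) (by positivity)]
    nlinarith [sq_nonneg ((k.1 : ℝ) ^ 2 - (k.2 : ℝ) ^ 2)]

/-- The condition `‖v‖ + 1 ≤ r` keeps the integrand nonnegative on the square, so `ENNReal.ofReal`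
truncates nothing. With `lintegral`, covering a disk by overlapping closed squares needs only
subadditivity. -/
lemma lintegral_translate_unitSquare_le {r : ℝ} {v : ℂ} (hv : 1 ≤ ‖v‖) (hr : ‖v‖ + 1 ≤ r) :
    ∫⁻ z in {z | z - v ∈ unitSquare}, ENNReal.ofReal (Real.log (r / ‖z‖)) ≤
      ENNReal.ofReal (Real.log (r / ‖v‖) + 1 / ‖v‖ ^ 4) := by
  have hpre : (fun w => v + w) ⁻¹' {z | z - v ∈ unitSquare} = unitSquare := by
    ext w; simp
  have h1 := (measurePreserving_add_left (volume : Measure ℂ) v).setLIntegral_comp_preimage_emb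
    (measurableEmbedding_addLeft v) (fun z => ENNReal.ofReal (Real.log (r / ‖z‖)))
    {z | z - v ∈ unitSquare}
  rw [hpre] at h1
  rw [← h1]
  have hr0 : 0 < r := by linarith
  have hi : IntegrableOn (fun w => Real.log ‖v + w‖) unitSquare := by
    simpa using (continuousOn_log_norm_add hv 1 (by simp)).integrableOn_compact isCompact_unitSquare
  have hic : IntegrableOn (fun _ : ℂ => Real.log r) unitSquare :=
    integrableOn_const (by simp [volume_unitSquare])
  have hpos : ∀ w ∈ unitSquare, 0 < ‖v + w‖ ∧ ‖v + w‖ ≤ r := fun w hw => by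
    have h2 := norm_lt_one_of_mem_unitSquare hw
    have h3 := norm_sub_le_norm_add v w
    have h4 := norm_add_le v w
    constructor <;> linarith
  have heq : Set.EqOn (fun w => Real.log r - Real.log ‖v + w‖)
      (fun w => Real.log (r / ‖v + w‖)) unitSquare := fun w hw =>
    (Real.log_div hr0.ne' (hpos w hw).1.ne').symm
  have hi2 : IntegrableOn (fun w => Real.log (r / ‖v + w‖)) unitSquare :=
    (hic.sub hi).congr_fun heq measurableSet_unitSquare
  rw [← ofReal_integral_eq_lintegral_ofReal hi2]
  · refine ENNReal.ofReal_le_ofReal ?_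
    rw [← setIntegral_congr_fun measurableSet_unitSquare heq, integral_sub hic hi,
      setIntegral_const, Real.log_div hr0.ne' (by linarith)]
    have hvol : volume.real unitSquare = 1 := by simp [Measure.real, volume_unitSquare]
    rw [hvol, one_smul]
    linarith [le_setIntegral_log_norm_add hv]
  · filter_upwards [ae_restrict_mem measurableSet_unitSquare] with w hw
    exact Real.log_nonneg ((one_le_div (hpos w hw).1).2 (hpos w hw).2)

lemma lintegral_ball_log_div {r ρ : ℝ} (hρ : 0 < ρ) (hr : ρ ≤ r) :
    ∫⁻ z in Metric.ball (0 : ℂ) ρ, ENNReal.ofReal (Real.log (r / ‖z‖)) =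
      ENNReal.ofReal (Real.pi * (ρ ^ 2 * Real.log (r / ρ) + ρ ^ 2 / 2)) := by
  obtain ⟨h1, h2⟩ := integral_ball_log_div hρ (hρ.trans_le hr)
  rw [← h2, ofReal_integral_eq_lintegral_ofReal h1]
  filter_upwards [ae_restrict_mem measurableSet_ball] with z hz
  rw [mem_ball_zero_iff] at hz
  rcases (norm_nonneg z).eq_or_lt with h | h
  · simp [← h]
  · exact Real.log_nonneg ((one_le_div h).2 (hz.le.trans hr))

/-- This is the cell of the omitted point `0`. Its `log r` is later cancelled by the zero at the
origin in Jensen's formula. -/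
lemma lintegral_unitSquare_log_div_le {r : ℝ} (hr : 1 ≤ r) :
    ∫⁻ z in unitSquare, ENNReal.ofReal (Real.log (r / ‖z‖)) ≤
      ENNReal.ofReal (Real.log r + Real.pi / 2) := by
  have h1 : ∀ z : ℂ, ENNReal.ofReal (Real.log (r / ‖z‖)) ≤
      ENNReal.ofReal (Real.log r) + ENNReal.ofReal (Real.log (1 / ‖z‖)) := by
    intro z
    rcases (norm_nonneg z).eq_or_lt with h | h
    · simp [← h]
    · rw [Real.log_div (by linarith) h.ne', Real.log_div one_ne_zero h.ne', Real.log_one, zero_sub,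
        sub_eq_add_neg]
      exact ENNReal.ofReal_add_le
  calc _ ≤ ∫⁻ z in unitSquare,
        (ENNReal.ofReal (Real.log r) + ENNReal.ofReal (Real.log (1 / ‖z‖))) :=
        lintegral_mono fun z => h1 z
    _ = ENNReal.ofReal (Real.log r) +
        ∫⁻ z in unitSquare, ENNReal.ofReal (Real.log (1 / ‖z‖)) := by
        rw [lintegral_add_left measurable_const, lintegral_const, Measure.restrict_apply_univ,
          volume_unitSquare, mul_one]
    _ ≤ ENNReal.ofReal (Real.log r) +
        ∫⁻ z in Metric.ball (0 : ℂ) 1, ENNReal.ofReal (Real.log (1 / ‖z‖)) := by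
        gcongr
        exact fun w hw => mem_ball_zero_iff.2 (norm_lt_one_of_mem_unitSquare hw)
    _ = _ := by
        rw [lintegral_ball_log_div one_pos le_rfl,
          ← ENNReal.ofReal_add (Real.log_nonneg hr) (by positivity)]
        congr 1
        simp
        ring

lemma exists_sub_gaussPoint_mem_unitSquare (z : ℂ) : ∃ k, z - gaussPoint k ∈ unitSquare := by
  refine ⟨(round z.re, round z.im), mem_unitSquare.2 ?_⟩
  simp only [gaussPoint]
  constructor
  · simpa using abs_sub_round z.re
  · simpa using abs_sub_round z.im

/-- Lower bound for the sum in Jensen's formula over the Gaussian integers. -/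
lemma exists_le_sum_posLog_gaussPoint :
    ∃ C : ℝ, ∀ r : ℝ, 4 ≤ r → ∀ T : Finset (ℤ × ℤ), 0 ∉ T →
      (∀ k ≠ 0, ‖gaussPoint k‖ < r → k ∈ T) →
      Real.pi * r ^ 2 / 2 - Real.log r - C ≤ ∑ k ∈ T, Real.posLog (r / ‖gaussPoint k‖) := by
  set B := ∑' k : ℤ × ℤ, 1 / ‖gaussPoint k‖ ^ 4
  refine ⟨Real.pi / 2 + B + 6 * Real.pi, fun r hr T hT0 hT => ?_⟩
  classical
  set S := T.filter fun k => ‖gaussPoint k‖ + 1 ≤ r with hS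
  -- Each square lies within distance `1` of its center, so a point of norm below `r - 2` belongs to
  -- a square whose center has norm at most `r - 1`.
  have hcover : Metric.ball (0 : ℂ) (r - 2) ⊆
      unitSquare ∪ ⋃ k : S, {z | z - gaussPoint k ∈ unitSquare} := by
    intro z hz
    rw [mem_ball_zero_iff] at hz
    obtain ⟨k, hk⟩ := exists_sub_gaussPoint_mem_unitSquare z
    by_cases hk0 : k = 0
    · left
      subst hk0
      simpa [gaussPoint] using hk
    · right
      have h1 := norm_lt_one_of_mem_unitSquare hk
      have h2 : ‖gaussPoint k‖ ≤ ‖z‖ + ‖z - gaussPoint k‖ := by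
        have := norm_sub_le z (z - gaussPoint k)
        simpa using this
      refine Set.mem_iUnion.2 ⟨⟨k, ?_⟩, hk⟩
      rw [hS, Finset.mem_filter]
      exact ⟨hT k hk0 (by linarith), by linarith⟩
  have hS1 : ∀ k ∈ S, 1 ≤ ‖gaussPoint k‖ ∧ ‖gaussPoint k‖ + 1 ≤ r := fun k hk => by
    rw [hS, Finset.mem_filter] at hk
    exact ⟨one_le_norm_gaussPoint fun h => hT0 (h ▸ hk.1), hk.2⟩
  have hnn : ∀ k ∈ S, 0 ≤ Real.log (r / ‖gaussPoint k‖) + 1 / ‖gaussPoint k‖ ^ 4 := fun k hk => by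
    obtain ⟨h1, h2⟩ := hS1 k hk
    have : 0 ≤ Real.log (r / ‖gaussPoint k‖) :=
      Real.log_nonneg ((one_le_div (by linarith)).2 (by linarith))
    positivity
  have hmain : ENNReal.ofReal (Real.pi * ((r - 2) ^ 2 * Real.log (r / (r - 2)) + (r - 2) ^ 2 / 2)) ≤
      ENNReal.ofReal (Real.log r + Real.pi / 2 +
        ∑ k ∈ S, (Real.log (r / ‖gaussPoint k‖) + 1 / ‖gaussPoint k‖ ^ 4)) := by
    rw [← lintegral_ball_log_div (by linarith) (by linarith)]
    refine (lintegral_mono_set hcover).trans ((lintegral_union_le _ _ _).trans ?_)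
    rw [ENNReal.ofReal_add (add_nonneg (Real.log_nonneg (by linarith)) (by positivity))
      (Finset.sum_nonneg hnn), ENNReal.ofReal_sum_of_nonneg hnn]
    refine add_le_add (lintegral_unitSquare_log_div_le (by linarith)) ?_
    refine (lintegral_iUnion_le _ _).trans ?_
    rw [tsum_fintype, ← Finset.sum_coe_sort S
      (fun k => ENNReal.ofReal (Real.log (r / ‖gaussPoint k‖) + 1 / ‖gaussPoint k‖ ^ 4))]
    exact Finset.sum_le_sum fun k _ => lintegral_translate_unitSquare_le (hS1 k k.2).1 (hS1 k k.2).2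
  rw [ENNReal.ofReal_le_ofReal_iff (by
    have := Real.log_nonneg (by linarith : 1 ≤ r)
    have := Finset.sum_nonneg hnn
    positivity), Finset.sum_add_distrib] at hmain
  have hB : ∑ k ∈ S, 1 / ‖gaussPoint k‖ ^ 4 ≤ B :=
    summable_inv_norm_gaussPoint_pow.sum_le_tsum S fun k _ => by positivity
  have hlog : ∑ k ∈ S, Real.log (r / ‖gaussPoint k‖) ≤ ∑ k ∈ T, Real.posLog (r / ‖gaussPoint k‖) := by
    refine (Finset.sum_le_sum fun k _ => ?_).trans
      (Finset.sum_le_sum_of_subset_of_nonneg (Finset.filter_subset _ _)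
        fun k _ _ => Real.posLog_nonneg)
    exact le_max_right _ _
  have hl : 2 / r ≤ Real.log (r / (r - 2)) := by
    have := Real.one_sub_inv_le_log_of_pos (x := r / (r - 2)) (div_pos (by linarith) (by linarith))
    rw [inv_div] at this
    refine le_trans (le_of_eq ?_) this
    have : r ≠ 0 := by linarith
    field_simp
    ring
  -- Using radius `r - 2` costs only a constant: with `log (r / (r - 2)) ≥ 2 / r` the terms linear
  -- in `r` cancel.
  have hA : r ^ 2 / 2 - 6 ≤ (r - 2) ^ 2 * Real.log (r / (r - 2)) + (r - 2) ^ 2 / 2 := by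
    have h1 : (r - 2) ^ 2 * (2 / r) ≤ (r - 2) ^ 2 * Real.log (r / (r - 2)) := by gcongr
    have h2 : (r - 2) ^ 2 * (2 / r) = 2 * r - 8 + 8 / r := by
      have : r ≠ 0 := by linarith
      field_simp
      ring
    have h3 : 0 < 8 / r := by positivity
    nlinarith
  have hA2 := mul_le_mul_of_nonneg_left hA Real.pi_pos.le
  linarith

lemma sum_Icc_int_inv_abs_le (N : ℕ) :
    ∑ m ∈ Finset.Icc (-(N : ℤ)) N, |(m : ℝ)|⁻¹ ≤ 2 * (harmonic N : ℝ) := by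
  induction N with
  | zero => simp
  | succ N ih =>
    have hset : Finset.Icc (-((N + 1 : ℕ) : ℤ)) ((N + 1 : ℕ) : ℤ) =
        insert (-((N : ℤ) + 1)) (insert ((N : ℤ) + 1) (Finset.Icc (-(N : ℤ)) N)) := by
      ext m
      simp only [Finset.mem_Icc, Finset.mem_insert]
      omega
    rw [hset, Finset.sum_insert (by simp; omega), Finset.sum_insert (by simp), harmonic_succ]
    have h : (0 : ℝ) < N + 1 := by positivity
    push_cast
    rw [abs_of_pos h, abs_of_neg (by linarith : -((N : ℝ) + 1) < 0), neg_neg]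
    linarith

/-- Lower bound for the sum in Jensen's formula over the shifted lattice. -/
lemma exists_le_sum_posLog_shiftedLattice {R : ℝ} (hR : 0 < R) :
    ∃ C : ℝ, ∀ r : ℝ, 4 ≤ r → ∃ T : Finset (ℤ × ℤ), 0 ∉ T ∧
      Real.pi * r ^ 2 / 2 - (1 + 2 * R) * Real.log r - C ≤
        ∑ k ∈ T, Real.posLog (r / ‖shiftedLattice 1 R k‖) := by
  obtain ⟨C, hC⟩ := exists_le_sum_posLog_gaussPoint
  refine ⟨C + 2 * R, fun r hr => ?_⟩
  classical
  set N := ⌊r⌋₊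
  set I := Finset.Icc (-(N : ℤ)) N with hI
  refine ⟨(I ×ˢ I).erase 0, by simp, ?_⟩
  have hr0 : 0 < r := by linarith
  have hmem : ∀ m : ℤ, |(m : ℝ)| < r → m ∈ I := by
    intro m hm
    have h1 : m.natAbs ≤ N := Nat.le_floor (by rw [Nat.cast_natAbs, Int.cast_abs]; exact hm.le)
    rw [hI, Finset.mem_Icc]
    omega
  have h1 := hC r hr ((I ×ˢ I).erase 0) (by simp) fun k hk hkr => by
    have h2 := norm_sq_gaussPoint k
    refine Finset.mem_erase.2 ⟨hk, Finset.mem_product.2 ⟨hmem _ ?_, hmem _ ?_⟩⟩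
    · refine lt_of_le_of_lt (abs_le_of_sq_le_sq ?_ (norm_nonneg _)) hkr
      nlinarith [sq_nonneg (k.2 : ℝ)]
    · refine lt_of_le_of_lt (abs_le_of_sq_le_sq ?_ (norm_nonneg _)) hkr
      nlinarith [sq_nonneg (k.1 : ℝ)]
  have hterm : ∀ k ∈ (I ×ˢ I).erase 0, Real.posLog (r / ‖gaussPoint k‖) ≤
      Real.posLog (r / ‖shiftedLattice 1 R k‖) + if k.2 = 0 then R * |(k.1 : ℝ)|⁻¹ else 0 := by
    rintro ⟨m, n⟩ hk
    by_cases hn : n = 0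
    · subst hn
      have hm : (m : ℝ) ≠ 0 := by
        rintro h
        have : m = 0 := by exact_mod_cast h
        subst this
        simp at hk
      have hm' : 0 < |(m : ℝ)| := abs_pos.2 hm
      have e1 : ‖gaussPoint (m, 0)‖ = |(m : ℝ)| := by simp [gaussPoint]
      have e2 : ‖shiftedLattice 1 R (m, 0)‖ = |(m : ℝ)| + R := by
        rw [shiftedLattice_axis, Complex.norm_real, Real.norm_eq_abs, one_mul]
        rcases signed_shift_cases R m with ⟨h, e⟩ | ⟨h, e⟩ | ⟨h, e⟩
        · rw [e, abs_of_neg h, abs_of_neg (by linarith)]; ring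
        · exact absurd h hm
        · rw [e, abs_of_pos h, abs_of_pos (by linarith)]
      rw [e1, e2, if_pos rfl]
      -- The shift costs at most `log (1 + R / |m|) ≤ R / |m|` for each axis point. Two harmonic
      -- sums up to `r` then give `2 R log r`, the source of the critical exponent.
      have e3 : r / |(m : ℝ)| = r / (|(m : ℝ)| + R) * (1 + R * |(m : ℝ)|⁻¹) := by
        have : |(m : ℝ)| + R ≠ 0 := by positivity
        field_simp
      rw [e3]
      refine Real.posLog_mul.trans ?_
      gcongr
      have e4 : 1 ≤ 1 + R * |(m : ℝ)|⁻¹ := by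
        have : 0 < R * |(m : ℝ)|⁻¹ := by positivity
        linarith
      rw [Real.posLog_eq_log (by rw [abs_of_pos (by linarith)]; exact e4)]
      linarith [Real.log_le_sub_one_of_pos (by linarith : 0 < 1 + R * |(m : ℝ)|⁻¹)]
    · rw [shiftedLattice_of_ne hn, if_neg hn, gaussPoint]
      simp
  have h2 := Finset.sum_le_sum hterm
  rw [Finset.sum_add_distrib] at h2
  have h3 : ∑ k ∈ (I ×ˢ I).erase 0, (if k.2 = 0 then R * |(k.1 : ℝ)|⁻¹ else 0) ≤
      R * (2 * (1 + Real.log r)) := by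
    calc _ ≤ ∑ k ∈ I ×ˢ I, (if k.2 = 0 then R * |(k.1 : ℝ)|⁻¹ else 0) :=
          Finset.sum_le_sum_of_subset_of_nonneg (Finset.erase_subset _ _) fun k _ _ => by
            split_ifs <;> positivity
      _ = R * ∑ m ∈ I, |(m : ℝ)|⁻¹ := by
          rw [Finset.sum_product, Finset.mul_sum]
          refine Finset.sum_congr rfl fun m _ => ?_
          rw [Finset.sum_ite_eq' I (0 : ℤ), if_pos (hmem 0 (by simpa using hr0))]
      _ ≤ R * (2 * (harmonic N : ℝ)) := by gcongr; exact sum_Icc_int_inv_abs_le N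
      _ ≤ _ := by gcongr; exact harmonic_floor_le_one_add_log r (by linarith)
  linarith

/-! ### Jensen's formula, Jensen's inequality and polar coordinates. -/

/-- A lower bound for circle averages from Jensen's formula, for simple zeros. -/
lemma sum_posLog_le_circleAverage {ι : Type*} {Λ : ι → ℂ} (hΛ : Function.Injective Λ) {i₀ : ι}
    (h0 : Λ i₀ = 0) {G : ℂ → ℂ} (hG : Differentiable ℂ G)
    (hord : ∀ z, analyticOrderAt G z = {i | Λ i = z}.encard) {T : Finset ι} (hT : i₀ ∉ T)
    {r : ℝ} (hr : 0 < r) :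
    ∑ k ∈ T, Real.posLog (r / ‖Λ k‖) + Real.log r + Real.log ‖meromorphicTrailingCoeffAt G 0‖ ≤
      Real.circleAverage (fun z => Real.log ‖G z‖) 0 r := by
  classical
  set U := Metric.closedBall (0 : ℂ) |r| with hU
  have han : AnalyticOnNhd ℂ G U := fun z _ => hG.analyticAt z
  have hdiv : ∀ k, Λ k ∈ U → MeromorphicOn.divisor G U (Λ k) = 1 := by
    intro k hk
    have hset : {i | Λ i = Λ k} = {k} := by
      ext l
      simp [hΛ.eq_iff]
    rw [MeromorphicOn.AnalyticOnNhd.divisor_apply han hk, hord, hset, Set.encard_singleton]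
    rfl
  have hdnn : ∀ u, 0 ≤ MeromorphicOn.divisor G U u := MeromorphicOn.AnalyticOnNhd.divisor_nonneg han
  have hfin : (Function.support fun u => (MeromorphicOn.divisor G U u : ℝ) *
      Real.log (r * ‖0 - u‖⁻¹)).Finite := by
    refine ((MeromorphicOn.divisor G U).finiteSupport (isCompact_closedBall 0 |r|)).subset ?_
    intro u hu h
    exact hu (by simp [h])
  rw [MeromorphicOn.circleAverage_log_norm hr.ne' han.meromorphicOn]
  have h00 : MeromorphicOn.divisor G U 0 = 1 := by
    rw [← h0]; exact hdiv i₀ (by simp [hU, h0])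
  rw [h00, Int.cast_one, one_mul]
  gcongr
  set T' := T.filter fun k => ‖Λ k‖ ≤ r with hT'
  have h1 : ∑ k ∈ T, Real.posLog (r / ‖Λ k‖) = ∑ k ∈ T', Real.posLog (r / ‖Λ k‖) := by
    rw [hT', Finset.sum_filter]
    refine Finset.sum_congr rfl fun k _ => ?_
    split_ifs with h
    · rfl
    · push Not at h
      rw [Real.posLog_eq_zero_iff, abs_of_nonneg (by positivity)]
      exact (div_le_one (hr.trans h)).2 h.le
  have h2 : ∀ k ∈ T', Real.posLog (r / ‖Λ k‖) =
      (MeromorphicOn.divisor G U (Λ k) : ℝ) * Real.log (r * ‖0 - Λ k‖⁻¹) := by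
    intro k hk
    rw [hT', Finset.mem_filter] at hk
    have hk0 : 0 < ‖Λ k‖ := norm_pos_iff.2 fun h => hT (by
      rw [← hΛ (h.trans h0.symm)]; exact hk.1)
    rw [hdiv k (by rw [hU, mem_closedBall_zero_iff, abs_of_pos hr]; exact hk.2), Int.cast_one,
      one_mul, zero_sub, norm_neg, ← div_eq_mul_inv]
    refine Real.posLog_eq_log ?_
    rw [abs_of_nonneg (by positivity)]
    exact (one_le_div hk0).2 hk.2
  rw [h1, Finset.sum_congr rfl h2, ← Finset.sum_image (f := fun u =>
    (MeromorphicOn.divisor G U u : ℝ) * Real.log (r * ‖0 - u‖⁻¹)) hΛ.injOn,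
    finsum_eq_sum_of_support_subset (s := hfin.toFinset ∪ T'.image Λ) _
      (fun u hu => by simpa using Or.inl hu)]
  -- Zeros outside `T` can only enlarge the sum. At `u = 0` the convention `log (r / 0) = 0`
  -- applies; the contribution of the origin is the separate term `log r`.
  refine Finset.sum_le_sum_of_subset_of_nonneg Finset.subset_union_right fun u _ _ => ?_
  by_cases hu : u ∈ U
  · refine mul_nonneg (by exact_mod_cast hdnn u) ?_
    rw [hU, mem_closedBall_zero_iff, abs_of_pos hr] at hu
    rw [zero_sub, norm_neg, ← div_eq_mul_inv]
    rcases (norm_nonneg u).eq_or_lt with h | h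
    · simp [← h]
    · exact Real.log_nonneg ((one_le_div h).2 hu)
  · rw [Function.locallyFinsuppWithin.apply_eq_zero_of_notMem _ hu]
    simp

lemma circleAverage_eq_integral_symm (f : ℂ → ℝ) (r : ℝ) :
    Real.circleAverage f 0 r = (2 * Real.pi)⁻¹ * ∫ θ in (-Real.pi)..Real.pi, f (circleMap 0 r θ) := by
  rw [Real.circleAverage_eq_integral_add (-Real.pi),
    intervalIntegral.integral_comp_add_right (fun θ => f (circleMap 0 r θ)), smul_eq_mul]
  congr 2 <;> ring

/-- Jensen's inequality for `|G|^q` on a circle without zeros of `G`. -/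
lemma exp_circleAverage_le_integral {G : ℂ → ℂ} (hG : Continuous G) (q : ℝ) {r : ℝ}
    (hne : ∀ θ, G (circleMap 0 r θ) ≠ 0) :
    2 * Real.pi * Real.exp (q * Real.circleAverage (fun z => Real.log ‖G z‖) 0 r) ≤
      ∫ θ in (-Real.pi)..Real.pi, ‖G (circleMap 0 r θ)‖ ^ q := by
  set A := Real.circleAverage (fun z => Real.log ‖G z‖) 0 r with hA
  have hGc : Continuous fun θ => G (circleMap 0 r θ) := hG.comp (continuous_circleMap 0 r)
  have hL : Continuous fun θ => Real.log ‖G (circleMap 0 r θ)‖ :=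
    hGc.norm.log fun θ => norm_ne_zero_iff.2 (hne θ)
  have hpow : Continuous fun θ => ‖G (circleMap 0 r θ)‖ ^ q :=
    hGc.norm.rpow_const fun θ => Or.inl (norm_ne_zero_iff.2 (hne θ))
  have hAi : ∫ θ in (-Real.pi)..Real.pi, Real.log ‖G (circleMap 0 r θ)‖ = 2 * Real.pi * A := by
    rw [hA, circleAverage_eq_integral_symm]
    field_simp
  -- The integrand is the tangent line of `exp` at `q * A`, evaluated at `q * log ‖G‖`; its
  -- nonconstant part has mean zero.
  have hval : ∫ θ in (-Real.pi)..Real.pi,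
      Real.exp (q * A) * ((1 - q * A) + q * Real.log ‖G (circleMap 0 r θ)‖) =
      2 * Real.pi * Real.exp (q * A) := by
    rw [intervalIntegral.integral_const_mul, intervalIntegral.integral_add
      (by simp) ((hL.const_mul q).intervalIntegrable _ _), intervalIntegral.integral_const_mul, hAi,
      intervalIntegral.integral_const]
    simp only [smul_eq_mul]
    ring
  rw [← hval]
  refine intervalIntegral.integral_mono_on (by linarith [Real.pi_pos]) ?_
    (hpow.intervalIntegrable _ _) fun θ _ => ?_
  · exact Continuous.intervalIntegrable (by fun_prop) _ _
  · have hpos := norm_pos_iff.2 (hne θ)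
    rw [Real.rpow_def_of_pos hpos]
    set L := Real.log ‖G (circleMap 0 r θ)‖
    have h1 := Real.add_one_le_exp (q * (L - A))
    calc _ = Real.exp (q * A) * (q * (L - A) + 1) := by ring
      _ ≤ Real.exp (q * A) * Real.exp (q * (L - A)) := by gcongr
      _ = _ := by rw [← Real.exp_add]; congr 1; ring

lemma lintegral_eq_lintegral_circleMap {F : ℂ → ℝ≥0∞} (hF : Measurable F) :
    ∫⁻ z, F z = ∫⁻ r in Set.Ioi (0 : ℝ), ENNReal.ofReal r *
      ∫⁻ θ in Set.Ioo (-Real.pi) Real.pi, F (circleMap 0 r θ) := by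
  have hc : Continuous fun p : ℝ × ℝ => circleMap 0 p.1 p.2 := by
    unfold circleMap; fun_prop
  have hsymm : ∀ p : ℝ × ℝ, Complex.polarCoord.symm p = circleMap 0 p.1 p.2 := fun p => by
    rw [Complex.polarCoord_symm_apply, circleMap_zero, Complex.exp_mul_I]
    push_cast
    rfl
  rw [← Complex.lintegral_comp_polarCoord_symm]
  simp only [hsymm, smul_eq_mul]
  have htarget : polarCoord.target = Set.Ioi (0 : ℝ) ×ˢ Set.Ioo (-Real.pi) Real.pi := rfl
  rw [htarget, Measure.volume_eq_prod, ← Measure.prod_restrict, lintegral_prod]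
  · refine lintegral_congr fun r => ?_
    exact lintegral_const_mul (ENNReal.ofReal r) (hF.comp (continuous_circleMap 0 r).measurable)
  · exact (measurable_fst.ennreal_ofReal.mul (hF.comp hc.measurable)).aemeasurable

/-! ### Failure of membership, and the conclusion. -/

lemma not_isFockZeroSet_shiftedLattice {a R q : ℝ} (ha : 0 < a) (hR : 0 < R) (hq : 0 < q)
    (hRq : R < 1 / q) : ¬ IsFockZeroSet (Real.pi / a ^ 2) q (shiftedLattice a R) := by
  rintro ⟨G, ⟨hG, hfin⟩, -, hord⟩
  obtain ⟨C, hC⟩ := exists_le_sum_posLog_shiftedLattice hR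
  have hinj := shiftedLattice_injective ha hR.le
  have hzero : shiftedLattice a R 0 = 0 := by simp [shiftedLattice]
  set c := Real.log ‖meromorphicTrailingCoeffAt G 0‖
  -- The term `(1 + 2R) log a` comes from replacing `r` by `r / a`. The zero at the origin supplies
  -- one `log r`, reducing the loss from `(1 + 2R) log r` to `2R log r`.
  set D := (1 + 2 * R) * Real.log a - C + c with hD
  have havg : ∀ r : ℝ, 4 * a ≤ r →
      Real.pi / a ^ 2 * r ^ 2 / 2 - 2 * R * Real.log r + D ≤
        Real.circleAverage (fun z => Real.log ‖G z‖) 0 r := by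
    intro r hr
    have hr0 : 0 < r := by linarith
    obtain ⟨T, hT0, hT⟩ := hC (r / a) ((le_div_iff₀ ha).2 hr)
    have h1 := sum_posLog_le_circleAverage hinj hzero hG hord hT0 hr0
    have h2 : ∑ k ∈ T, Real.posLog (r / ‖shiftedLattice a R k‖) =
        ∑ k ∈ T, Real.posLog (r / a / ‖shiftedLattice 1 R k‖) := by
      refine Finset.sum_congr rfl fun k _ => ?_
      rw [shiftedLattice_eq_mul, norm_mul, Complex.norm_real, Real.norm_of_nonneg ha.le, div_div]
    rw [h2] at h1
    rw [Real.log_div hr0.ne' ha.ne'] at hT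
    have h3 : Real.pi * (r / a) ^ 2 / 2 = Real.pi / a ^ 2 * r ^ 2 / 2 := by
      field_simp
    rw [h3] at hT
    rw [hD]
    linarith
  set β := q * (Real.pi / a ^ 2) / 2 with hβ
  have hβ0 : 0 < β := by positivity
  set K := 2 * β * Real.exp (q * D) with hK
  have hK0 : 0 < K := by positivity
  have hlower : ∀ᵐ r ∂(volume.restrict (Set.Ioi (4 * a))),
      ENNReal.ofReal (K * r ^ (1 - 2 * R * q)) ≤ ENNReal.ofReal r *
        ∫⁻ θ in Set.Ioo (-Real.pi) Real.pi, (fun z =>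
          ENNReal.ofReal (β / Real.pi * Real.exp (-β * ‖z‖ ^ 2)) * ‖G z‖ₑ ^ q) (circleMap 0 r θ) := by
    -- Only countably many radii give circles through a zero; discarding them makes `log ‖G‖`
    -- continuous on the circle.
    have hcount : ∀ᵐ r ∂(volume.restrict (Set.Ioi (4 * a))),
        r ∉ Set.range fun k => ‖shiftedLattice a R k‖ :=
      (Set.countable_range _).ae_notMem _
    filter_upwards [hcount, ae_restrict_mem measurableSet_Ioi] with r hr hra
    have hra' : 4 * a < r := hra
    have hr0 : 0 < r := by linarith
    have hne : ∀ θ, G (circleMap 0 r θ) ≠ 0 := by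
      intro θ h
      have h1 := hord (circleMap 0 r θ)
      have h2 : analyticOrderAt G (circleMap 0 r θ) ≠ 0 :=
        analyticOrderAt_ne_zero.2 ⟨hG.analyticAt _, h⟩
      rw [h1, Set.encard_ne_zero] at h2
      obtain ⟨k, hk⟩ := h2
      refine hr ⟨k, ?_⟩
      have hk' : shiftedLattice a R k = circleMap 0 r θ := hk
      simp only [hk', norm_circleMap_zero, abs_of_pos hr0]
    have hpow : Continuous fun θ => ‖G (circleMap 0 r θ)‖ ^ q :=
      (hG.continuous.comp (continuous_circleMap 0 r)).norm.rpow_const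
        fun θ => Or.inl (norm_ne_zero_iff.2 (hne θ))
    have hJ := exp_circleAverage_le_integral hG.continuous q hne
    have hinner : ∫⁻ θ in Set.Ioo (-Real.pi) Real.pi, (fun z =>
          ENNReal.ofReal (β / Real.pi * Real.exp (-β * ‖z‖ ^ 2)) * ‖G z‖ₑ ^ q) (circleMap 0 r θ) =
        ENNReal.ofReal (β / Real.pi * Real.exp (-β * r ^ 2) *
          ∫ θ in (-Real.pi)..Real.pi, ‖G (circleMap 0 r θ)‖ ^ q) := by
      have hi : IntegrableOn (fun θ => ‖G (circleMap 0 r θ)‖ ^ q) (Set.Ioo (-Real.pi) Real.pi) :=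
        (hpow.integrableOn_Icc (a := -Real.pi) (b := Real.pi)).mono_set Set.Ioo_subset_Icc_self
      rw [ENNReal.ofReal_mul (by positivity), intervalIntegral.integral_of_le
        (by linarith [Real.pi_pos]), integral_Ioc_eq_integral_Ioo,
        ofReal_integral_eq_lintegral_ofReal hi (Eventually.of_forall fun θ => by positivity),
        ← lintegral_const_mul _ hpow.measurable.ennreal_ofReal]
      refine lintegral_congr fun θ => ?_
      simp only [norm_circleMap_zero, abs_of_pos hr0]
      rw [← ofReal_norm, ENNReal.ofReal_rpow_of_nonneg (norm_nonneg _) hq.le]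
    rw [hinner, ← ENNReal.ofReal_mul hr0.le]
    refine ENNReal.ofReal_le_ofReal ?_
    have hexp : Real.exp (q * (Real.pi / a ^ 2 * r ^ 2 / 2 - 2 * R * Real.log r + D)) ≤
        Real.exp (q * Real.circleAverage (fun z => Real.log ‖G z‖) 0 r) :=
      Real.exp_le_exp.2 (mul_le_mul_of_nonneg_left (havg r hra'.le) hq.le)
    have hsplit : Real.exp (q * (Real.pi / a ^ 2 * r ^ 2 / 2 - 2 * R * Real.log r + D)) =
        Real.exp (β * r ^ 2) * r ^ (-(2 * R * q)) * Real.exp (q * D) := by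
      rw [Real.rpow_def_of_pos hr0, ← Real.exp_add, ← Real.exp_add, hβ]
      congr 1
      ring
    calc K * r ^ (1 - 2 * R * q)
        = r * (β / Real.pi * Real.exp (-β * r ^ 2) * (2 * Real.pi *
          (Real.exp (β * r ^ 2) * r ^ (-(2 * R * q)) * Real.exp (q * D)))) := by
          have h1 : r ^ (1 - 2 * R * q) = r * r ^ (-(2 * R * q)) := by
            rw [sub_eq_add_neg, Real.rpow_add hr0, Real.rpow_one]
          have h2 : Real.exp (-β * r ^ 2) * Real.exp (β * r ^ 2) = 1 := by
            rw [← Real.exp_add, neg_mul, neg_add_cancel, Real.exp_zero]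
          rw [h1, hK]
          have hπ := Real.pi_ne_zero
          rw [neg_mul] at h2 ⊢
          field_simp
          linear_combination (-1 : ℝ) * h2
      _ ≤ r * (β / Real.pi * Real.exp (-β * r ^ 2) * (2 * Real.pi *
          Real.exp (q * Real.circleAverage (fun z => Real.log ‖G z‖) 0 r))) := by
          rw [← hsplit]; gcongr
      _ ≤ _ := by gcongr
  have hmeas : Measurable fun z : ℂ =>
      ENNReal.ofReal (β / Real.pi * Real.exp (-β * ‖z‖ ^ 2)) * ‖G z‖ₑ ^ q := by
    have := hG.continuous.measurable
    fun_prop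
  have hlt : ∫⁻ r in Set.Ioi (4 * a), ENNReal.ofReal (K * r ^ (1 - 2 * R * q)) < ∞ := by
    refine lt_of_le_of_lt (lintegral_mono_ae hlower) (lt_of_le_of_lt
      (lintegral_mono_set (Set.Ioi_subset_Ioi (by positivity : 0 ≤ 4 * a))) ?_)
    rw [← lintegral_eq_lintegral_circleMap hmeas]
    rw [gaussianArea, lintegral_withDensity_eq_lintegral_mul₀ (by fun_prop)
      (by have := hG.continuous; fun_prop)] at hfin
    exact hfin
  have hint : IntegrableOn (fun r : ℝ => K * r ^ (1 - 2 * R * q)) (Set.Ioi (4 * a)) := by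
    refine ⟨by fun_prop, ?_⟩
    rw [hasFiniteIntegral_iff_ofReal]
    · exact hlt
    · filter_upwards [ae_restrict_mem measurableSet_Ioi] with r hr
      have : 0 < r := lt_trans (by positivity) (Set.mem_Ioi.1 hr)
      positivity
  have hint2 : IntegrableOn (fun r : ℝ => r ^ (1 - 2 * R * q)) (Set.Ioi (4 * a)) :=
    (integrable_const_mul_iff (IsUnit.mk0 K hK0.ne') _).1 hint
  -- Integrability would force `1 - 2Rq < -1`, that is `R q > 1`.
  rw [integrableOn_Ioi_rpow_iff (by positivity)] at hint2
  rw [lt_div_iff₀ hq] at hRq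
  linarith

/-- The shifted lattice separates the zero sets of `F^p_α` and `F^q_α` for `1 / p < R < 1 / q`. -/
theorem shiftedLattice_properties {α p q R : ℝ} (hα : 0 < α) (hp : 0 < p) (hq : 0 < q)
    (hpR : 1 / p < R) (hRq : R < 1 / q) :
    upperDensity (shiftedLattice (Real.sqrt (Real.pi / α)) R) = ENNReal.ofReal (α / Real.pi) ∧
    lowerDensity (shiftedLattice (Real.sqrt (Real.pi / α)) R) = ENNReal.ofReal (α / Real.pi) ∧
    IsFockZeroSet α p (shiftedLattice (Real.sqrt (Real.pi / α)) R) ∧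
    ¬ IsFockZeroSet α q (shiftedLattice (Real.sqrt (Real.pi / α)) R) := by
  have hR : 0 < R := lt_trans (by positivity) hpR
  set a := Real.sqrt (Real.pi / α) with ha_def
  have ha : 0 < a := Real.sqrt_pos.2 (by positivity)
  have ha2 : a ^ 2 = Real.pi / α := Real.sq_sqrt (by positivity)
  have hα2 : Real.pi / a ^ 2 = α := by
    rw [ha2, div_div_cancel₀ Real.pi_ne_zero]
  have hdens := densities_eq ha (dist_shiftedLattice_le ha hR.le)
  rw [ha2, one_div_div] at hdens
  have h1 := isFockZeroSet_shiftedLattice ha hp hpR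
  have h2 := not_isFockZeroSet_shiftedLattice ha hR hq hRq
  rw [hα2] at h1 h2
  exact ⟨hdens.1, hdens.2, h1, h2⟩

theorem theorem1 (α p q : ℝ) (hα : 0 < α) (hq : 0 < q) (hqp : q < p) :
    (∃ Λ : ℕ → ℂ,
      upperDensity Λ = ENNReal.ofReal (α / Real.pi) ∧
      lowerDensity Λ = ENNReal.ofReal (α / Real.pi) ∧
      IsFockZeroSet α p Λ ∧ ¬ IsFockZeroSet α q Λ) ∧
    ∀ R : ℝ, 1 / p < R → R < 1 / q →
      upperDensity (shiftedLattice (Real.sqrt (Real.pi / α)) R) = ENNReal.ofReal (α / Real.pi) ∧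
      lowerDensity (shiftedLattice (Real.sqrt (Real.pi / α)) R) = ENNReal.ofReal (α / Real.pi) ∧
      IsFockZeroSet α p (shiftedLattice (Real.sqrt (Real.pi / α)) R) ∧
      ¬ IsFockZeroSet α q (shiftedLattice (Real.sqrt (Real.pi / α)) R) := by
  have hp : 0 < p := hq.trans hqp
  refine ⟨?_, fun R h1 h2 => shiftedLattice_properties hα hp hq h1 h2⟩
  obtain ⟨R, h1, h2⟩ := exists_between (one_div_lt_one_div_of_lt hq hqp)
  obtain ⟨h3, h4, h5, h6⟩ := shiftedLattice_properties hα hp hq h1 h2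
  let e : ℕ ≃ ℤ × ℤ := (Denumerable.eqv (ℤ × ℤ)).symm
  refine ⟨shiftedLattice (Real.sqrt (Real.pi / α)) R ∘ e, ?_, ?_, ?_, ?_⟩
  · rw [upperDensity_comp_equiv, h3]
  · rw [lowerDensity_comp_equiv, h4]
  · rwa [isFockZeroSet_comp_equiv]
  · rwa [isFockZeroSet_comp_equiv]
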